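/- All Hilbert spaces are finite-dimensional and complex. $D(H)$ is the set of density operators on $H$. $S(A,B)$ is the set of separable states on $A\otimes B$, i.e. the convex combinations of product states $\sigma_A\otimes\tau_B$ with $\sigma_A\in D(A)$, $\tau_B\in D(B)$. The generalized robustness of entanglement of $\rho\in D(A\otimes B)$ is $$R(\rho)=\inf\Bigl\{\lambda\ge 0 \;\Big|\; \tfrac{\rho+\lambda\omega}{1+\lambda}\in S(A,B)\text{ for some }\omega\in D(A\otimes B)\Bigr\}.$$ $\mathrm{LOCC}(A,B)$ denotes the set of completely positive trace-nonincreasing superoperators on $A\otimes B$ that are realized by finitely many rounds of local operations (with local ancillas, and possibly with some measurement outcomes discarded) and two-way classical communication. Let $A,B,C$ be $2^n$-dimensional and let $\rho$ be a state on $B\otimes C$. The optimal sampling overhead of a parallel cut of $n$ wires (the identity $\mathcal I^{\otimes n}$ from $A$ to $C$) with resource state $\rho$ is $$\gamma^{\rho}(\mathcal I^{\otimes n})=\inf\Bigl\{\sum_i|c_i| \;\Big|\; \mathcal V=\sum_i c_i\mathcal F_i,\ c_i\in\mathbb R,\ \sum_i c_i=1,\ \mathcal F_i\in\mathrm{LOCC}(A\otimes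 B,C),\ \operatorname{Tr}_{AB}[\mathcal V(\varphi\otimes\rho)]=\varphi\ \ \forall\varphi\in D(A)\Bigr\},$$ where the sums are finite and, in the last condition, $A$ and $C$ are identified through their computational bases. **Theorem.** Let $m\ge 2$ and, for $i=0,\dots,m-1$, let $\rho^{(i)}\in D(A_i\otimes B_i)$ be a density operator, where $A_i$ and $B_i$ are $2^{k_i}$-dimensional Hilbert spaces; put $n=\sum_{i=0}^{m-1}k_i$. Suppose that every $\rho^{(i)}$ is a non-maximally entangled (NME) state in the sense that $0\le R(\rho^{(i)})<2^{k_i}-1$. Let $\rho=\bigotimes_{i=0}^{m-1}\rho^{(i)}$, regarded as a bipartite state between $A=\bigotimes_i A_i$ and $B=\bigotimes_i B_i$. Then $$\prod_{i=0}^{m-1}\gamma^{\rho^{(i)}}(\mathcal I^{\otimes k_i})>\gamma^{\rho}(\mathcal I^{\otimes n}).$$ -/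

import Mathlib

open scoped Kronecker ComplexOrder

noncomputable section

namespace WireCut

/-- The computational basis of a register of `n` qubits. Operators on the register are the complex
matrices indexed by it, and operators on a tensor product `A ⊗ B` are the matrices indexed by the
product of the bases of `A` and `B`. -/
abbrev Qubits (n : ℕ) : Type := Fin n → Fin 2

/-- Superoperators, i.e. linear maps from the operators on one space to those on another. -/
abbrev SuperOp (a a' : Type) : Type := Matrix a a ℂ →ₗ[ℂ] Matrix a' a' ℂ

/-- `ρ ∈ D(H)`: density operators. -/
def IsDensity {a : Type} [Fintype a] (ρ : Matrix a a ℂ) : Prop :=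
  ρ.PosSemidef ∧ ρ.trace = 1

/-- `S(A, B)`: the separable states, i.e. the convex combinations of product states. -/
def separableStates (a b : Type) [Fintype a] [Fintype b] : Set (Matrix (a × b) (a × b) ℂ) :=
  convexHull ℝ {X | ∃ (σ : Matrix a a ℂ) (τ : Matrix b b ℂ),
    IsDensity σ ∧ IsDensity τ ∧ X = σ ⊗ₖ τ}

/-- The generalized robustness of entanglement of a bipartite state. -/
def robustness {a b : Type} [Fintype a] [Fintype b] (ρ : Matrix (a × b) (a × b) ℂ) : ℝ :=
  sInf {l : ℝ | 0 ≤ l ∧ ∃ ω : Matrix (a × b) (a × b) ℂ, IsDensity ω ∧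
    (1 + l)⁻¹ • (ρ + l • ω) ∈ separableStates a b}

/-- The superoperator `X ↦ K X K†`. -/
def krausMap {a a' : Type} [Fintype a] (K : Matrix a' a ℂ) : SuperOp a a' where
  toFun X := K * X * K.conjTranspose
  map_add' X Y := by rw [Matrix.mul_add, Matrix.add_mul]
  map_smul' r X := by simp

/-- `IsLOCC a b Λ`: the superoperator `Λ`, taking operators on `A ⊗ B` to operators on `A' ⊗ B'`, is
completely positive trace-nonincreasing and realized by a protocol of local operations and classical
communication with finitely many rounds.

In a round, one of the two parties applies a local quantum operation with Kraus operators `K j`,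
possibly changing the dimension of the local space (adding or discarding local ancillas), and
announces `j`; the parties then continue with a protocol that may depend on `j`. Outcomes may be
discarded, whence `∑ j, (K j)† K j ≤ 1` instead of equality. An outcome that is to be kept secret
is one that the subsequent protocols ignore. -/
inductive IsLOCC {a' b' : Type} [Fintype a'] [Fintype b'] [DecidableEq a'] [DecidableEq b'] :
    ∀ (a b : Type) [Fintype a] [Fintype b] [DecidableEq a] [DecidableEq b],
      SuperOp (a × b) (a' × b') → Prop
  | done : IsLOCC a' b' LinearMap.id
  | left {a b a₁ : Type} [Fintype a] [Fintype b] [Fintype a₁]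
      [DecidableEq a] [DecidableEq b] [DecidableEq a₁]
      (N : ℕ) (K : Fin N → Matrix a₁ a ℂ)
      (hK : (1 - ∑ j, (K j).conjTranspose * K j).PosSemidef)
      (Λ : Fin N → SuperOp (a₁ × b) (a' × b')) (hΛ : ∀ j, IsLOCC a₁ b (Λ j)) :
      IsLOCC a b (∑ j, Λ j ∘ₗ krausMap (K j ⊗ₖ (1 : Matrix b b ℂ)))
  | right {a b b₁ : Type} [Fintype a] [Fintype b] [Fintype b₁]
      [DecidableEq a] [DecidableEq b] [DecidableEq b₁]
      (N : ℕ) (K : Fin N → Matrix b₁ b ℂ)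
      (hK : (1 - ∑ j, (K j).conjTranspose * K j).PosSemidef)
      (Λ : Fin N → SuperOp (a × b₁) (a' × b')) (hΛ : ∀ j, IsLOCC a b₁ (Λ j)) :
      IsLOCC a b (∑ j, Λ j ∘ₗ krausMap ((1 : Matrix a a ℂ) ⊗ₖ K j))

/-- The partial trace over the first tensor factor. -/
def traceFirst {a b : Type} [Fintype a] (X : Matrix (a × b) (a × b) ℂ) : Matrix b b ℂ :=
  Matrix.of fun y y' => ∑ x, X (x, y) (x, y')

/-- The operator `φ_A ⊗ ρ_{BC}`, regarded as an operator on `(A ⊗ B) ⊗ C`. -/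
def withResource {a b c : Type} (φ : Matrix a a ℂ) (ρ : Matrix (b × c) (b × c) ℂ) :
    Matrix ((a × b) × c) ((a × b) × c) ℂ :=
  (φ ⊗ₖ ρ).submatrix (Equiv.prodAssoc a b c) (Equiv.prodAssoc a b c)

/-- `∑ i, c i F i` is a quasiprobability decomposition, into operations in `LOCC(A ⊗ B, C)`, of a
superoperator `V` on `A ⊗ B ⊗ C` that implements the identity from `A` to `C` by means of the
resource state `ρ` on `B ⊗ C`: the sum of the coefficients is one, and
`Tr_{AB} [V (φ ⊗ ρ)] = φ` for every density operator `φ`. The spaces `A`, `B` and `C` have the same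
dimension, and `d` indexes an orthonormal basis of each. -/
def IsWireCut {d : Type} [Fintype d] [DecidableEq d] (ρ : Matrix (d × d) (d × d) ℂ)
    {N : ℕ} (c : Fin N → ℝ) (F : Fin N → SuperOp ((d × d) × d) ((d × d) × d)) : Prop :=
  (∀ i, IsLOCC (d × d) d (F i)) ∧ ∑ i, c i = 1 ∧
    ∀ φ : Matrix d d ℂ, IsDensity φ →
      traceFirst ((∑ i, (c i : ℂ) • F i) (withResource φ ρ)) = φ

/-- The optimal sampling overhead for cutting the identity with the resource state `ρ`. For
`d = Qubits n` this is the overhead of the parallel cut of `n` wires. -/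
def overhead {d : Type} [Fintype d] [DecidableEq d] (ρ : Matrix (d × d) (d × d) ℂ) : ℝ :=
  sInf {κ : ℝ | ∃ (N : ℕ) (c : Fin N → ℝ) (F : Fin N → SuperOp ((d × d) × d) ((d × d) × d)),
    IsWireCut ρ c F ∧ κ = ∑ i, |c i|}

/-- The `i`-th block of a basis label of the joint register of `∑ i, k i` qubits. -/
def block {m : ℕ} {k : Fin m → ℕ} (x : Qubits (∑ i, k i)) (i : Fin m) : Qubits (k i) :=
  fun j => x (finSigmaFinEquiv ⟨i, j⟩)

/-- The composite state `⨂ i, ρ i`, regarded as a bipartite operator on `A ⊗ B` with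
`A = ⨂ i, A i` and `B = ⨂ i, B i`. -/
def compositeState {m : ℕ} {k : Fin m → ℕ}
    (ρ : ∀ i, Matrix (Qubits (k i) × Qubits (k i)) (Qubits (k i) × Qubits (k i)) ℂ) :
    Matrix (Qubits (∑ i, k i) × Qubits (∑ i, k i)) (Qubits (∑ i, k i) × Qubits (∑ i, k i)) ℂ :=
  Matrix.of fun p q => ∏ i, ρ i (block p.1 i, block p.2 i) (block q.1 i, block q.2 i)

end WireCut

end

/-!
Let `F` be the largest entanglement fidelity, failure counted as zero, with which an operation
realized by LOCC with the resource `ρ` simulates the identity. Then `overhead ρ = 2 / F - 1`: every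
term of a wire cut has fidelity between `0` and `F`, and the coefficients sum to `1`, which bounds
`∑ |c i|` from below; conversely, twirling a near-optimal simulation by monomial unitaries and by
the Fourier matrix makes it a combination of the identity and a uniform mixture of errors, and this
mixture can itself be realized and subtracted.

Simulations can be run in parallel, so `F` is supermultiplicative and the theorem reduces to
`2 ∏ y i - 1 < ∏ (2 y i - 1)` for `y i = 1 / F i ≥ 1`, which holds as soon as two of the `y i`
exceed `1`. They do: a separable resource only yields entanglement-breaking operations, whose
fidelity is at most `1 / d`, so `F ≤ (1 + R) / d < 1` for a resource of robustness `R < d - 1`.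
-/

noncomputable section

namespace WireCut

open Matrix

section KrausFamily

variable {ι x y z : Type} [Fintype ι] [Fintype y] [DecidableEq x]

/-- The Kraus operators of a completely positive trace-nonincreasing map: `∑ j, (K j)ᴴ * K j ≤ 1`,
spelled as in the definition of `IsLOCC`. -/
def IsKrausFamily (K : ι → Matrix y x ℂ) : Prop :=
  (1 - ∑ j, (K j)ᴴ * K j).PosSemidef

theorem IsKrausFamily.of_sum_eq_one {K : ι → Matrix y x ℂ} (hK : ∑ j, (K j)ᴴ * K j = 1) :
    IsKrausFamily K := by
  rw [IsKrausFamily, hK, sub_self]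
  exact .zero

theorem IsKrausFamily.of_isometry {K : Matrix y x ℂ} (hK : Kᴴ * K = 1) :
    IsKrausFamily fun _ : Unit => K :=
  .of_sum_eq_one (by simpa using hK)

theorem IsKrausFamily.comp {κ : ι → Type} [∀ i, Fintype (κ i)] [Finite x] [Fintype z]
    [DecidableEq y] {K : ι → Matrix y x ℂ} (hK : IsKrausFamily K) {L : ∀ i, κ i → Matrix z y ℂ}
    (hL : ∀ i, IsKrausFamily (L i)) :
    IsKrausFamily fun q : Σ i, κ i => L q.1 q.2 * K q.1 := by
  have h : 1 - ∑ q : Σ i, κ i, (L q.1 q.2 * K q.1)ᴴ * (L q.1 q.2 * K q.1) =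
      (1 - ∑ i, (K i)ᴴ * K i) + ∑ i, (K i)ᴴ * (1 - ∑ l, (L i l)ᴴ * L i l) * K i := by
    simp only [Fintype.sum_sigma, Matrix.mul_sub, Matrix.sub_mul, Finset.sum_sub_distrib,
      Matrix.mul_one, Matrix.mul_sum, Matrix.sum_mul, conjTranspose_mul, Matrix.mul_assoc]
    abel
  rw [IsKrausFamily, h]
  exact hK.add (posSemidef_sum _ fun i _ => (hL i).conjTranspose_mul_mul_same _)

theorem IsKrausFamily.kronecker_one [Finite x] [Fintype z] [DecidableEq z] {K : ι → Matrix y x ℂ}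
    (hK : IsKrausFamily K) : IsKrausFamily fun j => K j ⊗ₖ (1 : Matrix z z ℂ) := by
  have h : (1 - ∑ j, (K j)ᴴ * K j) ⊗ₖ (1 : Matrix z z ℂ) =
      1 - ∑ j, (K j ⊗ₖ (1 : Matrix z z ℂ))ᴴ * (K j ⊗ₖ (1 : Matrix z z ℂ)) := by
    change kroneckerBilinear (R := ℂ) (α := ℂ) _ _ = _
    rw [map_sub, map_sum, LinearMap.sub_apply, LinearMap.sum_apply]
    simp [kroneckerBilinear, kroneckerMapBilinear, conjTranspose_kronecker, ← mul_kronecker_mul]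
  rw [IsKrausFamily, ← h]
  exact PosSemidef.kronecker hK .one

theorem IsKrausFamily.one_kronecker [Finite x] [Fintype z] [DecidableEq z] {K : ι → Matrix y x ℂ}
    (hK : IsKrausFamily K) : IsKrausFamily fun j => (1 : Matrix z z ℂ) ⊗ₖ K j := by
  have h : (1 : Matrix z z ℂ) ⊗ₖ (1 - ∑ j, (K j)ᴴ * K j) =
      1 - ∑ j, ((1 : Matrix z z ℂ) ⊗ₖ K j)ᴴ * ((1 : Matrix z z ℂ) ⊗ₖ K j) := by
    change kroneckerBilinear (R := ℂ) (α := ℂ) _ _ = _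
    rw [map_sub, map_sum]
    simp [kroneckerBilinear, kroneckerMapBilinear, conjTranspose_kronecker, ← mul_kronecker_mul]
  rw [IsKrausFamily, ← h]
  exact PosSemidef.kronecker .one hK

theorem IsKrausFamily.sum_trace_le [Fintype x] {K : ι → Matrix y x ℂ} (hK : IsKrausFamily K) :
    ∑ j, ((K j)ᴴ * K j).trace ≤ Fintype.card x := by
  have h := hK.trace_nonneg
  rwa [trace_sub, trace_one, trace_sum, sub_nonneg] at h

@[simp]
theorem krausMap_apply {x y : Type} [Fintype x] (K : Matrix y x ℂ) (X : Matrix x x ℂ) :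
    krausMap K X = K * X * Kᴴ := rfl

theorem krausMap_comp {x y z : Type} [Fintype x] [Fintype y] (K : Matrix z y ℂ)
    (L : Matrix y x ℂ) : krausMap K ∘ₗ krausMap L = krausMap (K * L) := by
  ext1 X
  simp [conjTranspose_mul, Matrix.mul_assoc]

theorem sum_krausMap_comp {x y z : Type} [Fintype x] [Fintype y] {κ : Type} [Fintype κ]
    (L : κ → Matrix z y ℂ) (K : Matrix y x ℂ) :
    (∑ l, krausMap (L l)) ∘ₗ krausMap K = ∑ l, krausMap (L l * K) := by
  simp only [← krausMap_comp]
  ext1 X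
  simp

theorem krausMap_one {x : Type} [Fintype x] [DecidableEq x] :
    krausMap (1 : Matrix x x ℂ) = LinearMap.id := by
  ext1 X
  simp

theorem krausMap_one_submatrix {x y : Type} [Fintype x] [DecidableEq x] (e : y → x)
    (X : Matrix x x ℂ) :
    krausMap ((1 : Matrix x x ℂ).submatrix e id) X = X.submatrix e e := by
  ext i j
  simp [Matrix.mul_apply, Matrix.one_apply]

end KrausFamily

section LOCC

variable {a b a' b' a'' b'' x y : Type} [Fintype a] [Fintype b] [Fintype a'] [Fintype b']
  [DecidableEq a] [DecidableEq b] [DecidableEq a'] [DecidableEq b']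

theorem IsLOCC.left_fintype {ι a₁ : Type} [Fintype ι] [Fintype a₁] [DecidableEq a₁]
    {K : ι → Matrix a₁ a ℂ} (hK : IsKrausFamily K)
    {Λ : ι → SuperOp (a₁ × b) (a' × b')} (hΛ : ∀ j, IsLOCC a₁ b (Λ j)) :
    IsLOCC a b (∑ j, Λ j ∘ₗ krausMap (K j ⊗ₖ (1 : Matrix b b ℂ))) := by
  have e := (Fintype.equivFin ι).symm
  rw [IsKrausFamily, ← e.sum_comp] at hK
  rw [← e.sum_comp]
  exact .left _ (fun j => K (e j)) hK (fun j => Λ (e j)) fun j => hΛ _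

theorem IsLOCC.right_fintype {ι b₁ : Type} [Fintype ι] [Fintype b₁] [DecidableEq b₁]
    {K : ι → Matrix b₁ b ℂ} (hK : IsKrausFamily K)
    {Λ : ι → SuperOp (a × b₁) (a' × b')} (hΛ : ∀ j, IsLOCC a b₁ (Λ j)) :
    IsLOCC a b (∑ j, Λ j ∘ₗ krausMap ((1 : Matrix a a ℂ) ⊗ₖ K j)) := by
  have e := (Fintype.equivFin ι).symm
  rw [IsKrausFamily, ← e.sum_comp] at hK
  rw [← e.sum_comp]
  exact .right _ (fun j => K (e j)) hK (fun j => Λ (e j)) fun j => hΛ _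

theorem IsLOCC.comp [Fintype a''] [Fintype b''] [DecidableEq a''] [DecidableEq b'']
    {Λ' : SuperOp (a' × b') (a'' × b'')} (h' : IsLOCC a' b' Λ')
    {Λ : SuperOp (a × b) (a' × b')} (h : IsLOCC a b Λ) : IsLOCC a b (Λ' ∘ₗ Λ) := by
  induction h with
  | done => exact h'
  | left N K hK _ _ ih =>
    convert IsLOCC.left N K hK _ ih using 1
    ext1 X
    simp
  | right N K hK _ _ ih =>
    convert IsLOCC.right N K hK _ ih using 1
    ext1 X
    simp

theorem IsLOCC.krausMap_kronecker {K : Matrix a' a ℂ} (hK : Kᴴ * K = 1)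
    {L : Matrix b' b ℂ} (hL : Lᴴ * L = 1) : IsLOCC a b (krausMap (K ⊗ₖ L)) := by
  have hright : IsLOCC a' b (krausMap ((1 : Matrix a' a' ℂ) ⊗ₖ L)) := by
    simpa using IsLOCC.right_fintype (.of_isometry hL) fun _ => IsLOCC.done (a' := a')
  simpa [krausMap_comp, ← mul_kronecker_mul] using
    IsLOCC.left_fintype (.of_isometry hK) fun _ => hright

theorem IsLOCC.relabel (e : a' ≃ a) (f : b' ≃ b) :
    IsLOCC a b (krausMap ((1 : Matrix (a × b) (a × b) ℂ).submatrix (Prod.map e f) id)) := by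
  have hiso {x y : Type} [Fintype x] [Fintype y] [DecidableEq x] (g : y ≃ x) :
      ((1 : Matrix x x ℂ).submatrix g id)ᴴ * (1 : Matrix x x ℂ).submatrix g id = 1 := by
    simp [conjTranspose_submatrix]
  have hprod : (1 : Matrix (a × b) (a × b) ℂ).submatrix (Prod.map e f) id =
      (1 : Matrix a a ℂ).submatrix e id ⊗ₖ (1 : Matrix b b ℂ).submatrix f id := by
    rw [← one_kronecker_one]
    rfl
  rw [hprod]
  exact .krausMap_kronecker (hiso e) (hiso f)

theorem IsLOCC.sum_smul {ι : Type} [Fintype ι] {p : ι → ℝ} (hp : ∀ j, 0 ≤ p j)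
    (hp' : ∑ j, p j ≤ 1) {Λ : ι → SuperOp (a × b) (a' × b')} (hΛ : ∀ j, IsLOCC a b (Λ j)) :
    IsLOCC a b (∑ j, (p j : ℂ) • Λ j) := by
  have hK : IsKrausFamily fun j => ((√(p j) : ℝ) : ℂ) • (1 : Matrix a a ℂ) := by
    have h : 1 - ∑ j, (((√(p j) : ℝ) : ℂ) • (1 : Matrix a a ℂ))ᴴ *
        (((√(p j) : ℝ) : ℂ) • (1 : Matrix a a ℂ)) =
        ((1 - ∑ j, p j : ℝ) : ℂ) • (1 : Matrix a a ℂ) := by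
      simp [smul_smul, fun j => Real.mul_self_sqrt (hp j), sub_smul, Finset.sum_smul]
    rw [IsKrausFamily, h]
    exact PosSemidef.one.smul (by exact_mod_cast sub_nonneg.2 hp')
  convert IsLOCC.left_fintype hK hΛ using 2 with j
  ext1 X
  simp [smul_kronecker, smul_smul, Real.mul_self_sqrt (hp j)]

theorem IsLOCC.exists_kraus {Λ : SuperOp (a × b) (a' × b')} (h : IsLOCC a b Λ) :
    ∃ (ι : Type) (_ : Fintype ι) (P : ι → Matrix a' a ℂ) (Q : ι → Matrix b' b ℂ),
      Λ = ∑ j, krausMap (P j ⊗ₖ Q j) ∧ IsKrausFamily fun j => P j ⊗ₖ Q j := by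
  induction h with
  | done => exact ⟨Unit, inferInstance, fun _ => 1, fun _ => 1, by simp [krausMap_one],
      .of_isometry (by simp)⟩
  | left N K hK Λ _ ih =>
    choose κ _ P Q hΛ hPQ using ih
    refine ⟨Σ j, κ j, inferInstance, fun q => P q.1 q.2 * K q.1, fun q => Q q.1 q.2, ?_, ?_⟩
    · simp only [hΛ, sum_krausMap_comp, ← mul_kronecker_mul, Matrix.mul_one, Fintype.sum_sigma]
    · have hcomp := IsKrausFamily.comp (IsKrausFamily.kronecker_one hK) hPQ
      simp only [← mul_kronecker_mul, Matrix.mul_one] at hcomp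
      exact hcomp
  | right N K hK Λ _ ih =>
    choose κ _ P Q hΛ hPQ using ih
    refine ⟨Σ j, κ j, inferInstance, fun q => P q.1 q.2, fun q => Q q.1 q.2 * K q.1, ?_, ?_⟩
    · simp only [hΛ, sum_krausMap_comp, ← mul_kronecker_mul, Matrix.mul_one, Fintype.sum_sigma]
    · have hcomp := IsKrausFamily.comp (IsKrausFamily.one_kronecker hK) hPQ
      simp only [← mul_kronecker_mul, Matrix.mul_one] at hcomp
      exact hcomp

end LOCC

section Tensor

variable {a b a' b' x y x' y' : Type}

/-- The tensor product of a bipartite operator on `A ⊗ B` and one on `X ⊗ Y`, as a bipartite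
operator on `(A ⊗ X) ⊗ (B ⊗ Y)`. -/
def tensor (Y : Matrix (a × b) (a × b) ℂ) (Z : Matrix (x × y) (x × y) ℂ) :
    Matrix ((a × x) × (b × y)) ((a × x) × (b × y)) ℂ :=
  (Y ⊗ₖ Z).submatrix (Equiv.prodProdProdComm a x b y) (Equiv.prodProdProdComm a x b y)

theorem tensor_sum_left {ι : Type} (s : Finset ι) (Y : ι → Matrix (a × b) (a × b) ℂ)
    (Z : Matrix (x × y) (x × y) ℂ) : tensor (∑ j ∈ s, Y j) Z = ∑ j ∈ s, tensor (Y j) Z := by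
  ext p q
  simp [tensor, Matrix.sum_apply, Finset.sum_mul]

theorem tensor_swap (Y : Matrix (a × b) (a × b) ℂ) (Z : Matrix (x × y) (x × y) ℂ) :
    (tensor Y Z).submatrix (Prod.map (Equiv.prodComm x a) (Equiv.prodComm y b))
      (Prod.map (Equiv.prodComm x a) (Equiv.prodComm y b)) = tensor Z Y := by
  ext p q
  exact mul_comm _ _

variable [Fintype a] [Fintype b] [Fintype x] [Fintype y]

theorem krausMap_tensor (K : Matrix a' a ℂ) (L : Matrix b' b ℂ) (K' : Matrix x' x ℂ)
    (L' : Matrix y' y ℂ) (Y : Matrix (a × b) (a × b) ℂ) (Z : Matrix (x × y) (x × y) ℂ) :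
    krausMap ((K ⊗ₖ K') ⊗ₖ (L ⊗ₖ L')) (tensor Y Z) =
      tensor (krausMap (K ⊗ₖ L) Y) (krausMap (K' ⊗ₖ L') Z) := by
  have h : (K ⊗ₖ K') ⊗ₖ (L ⊗ₖ L') = ((K ⊗ₖ L) ⊗ₖ (K' ⊗ₖ L')).submatrix
      (Equiv.prodProdProdComm a' x' b' y') (Equiv.prodProdProdComm a x b y) := by
    ext p q
    exact mul_mul_mul_comm _ _ _ _
  simp only [h, krausMap_apply, tensor, conjTranspose_submatrix, submatrix_mul_equiv,
    conjTranspose_kronecker, mul_kronecker_mul]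

variable [Fintype a'] [Fintype b'] [Fintype x'] [Fintype y'] [DecidableEq a] [DecidableEq b]
  [DecidableEq a'] [DecidableEq b'] [DecidableEq x] [DecidableEq y] [DecidableEq x']
  [DecidableEq y']

theorem IsLOCC.exists_tensor_left (x y : Type) [Fintype x] [Fintype y] [DecidableEq x]
    [DecidableEq y] {Λ : SuperOp (a × b) (a' × b')} (h : IsLOCC a b Λ) :
    ∃ G : SuperOp ((a × x) × (b × y)) ((a' × x) × (b' × y)), IsLOCC (a × x) (b × y) G ∧
      ∀ Y Z, G (tensor Y Z) = tensor (Λ Y) Z := by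
  induction h with
  | done => exact ⟨_, .done, fun Y Z => rfl⟩
  | left N K hK Λ _ ih =>
    choose G hG hGΛ using ih
    refine ⟨_, .left N _ (IsKrausFamily.kronecker_one hK) G hG, fun Y Z => ?_⟩
    simp only [LinearMap.sum_apply, LinearMap.comp_apply, tensor_sum_left, ← one_kronecker_one,
      krausMap_tensor, hGΛ]
    simp only [one_kronecker_one, krausMap_one, LinearMap.id_apply]
  | right N K hK Λ _ ih =>
    choose G hG hGΛ using ih
    refine ⟨_, .right N _ (IsKrausFamily.kronecker_one hK) G hG, fun Y Z => ?_⟩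
    simp only [LinearMap.sum_apply, LinearMap.comp_apply, tensor_sum_left, ← one_kronecker_one,
      krausMap_tensor, hGΛ]
    simp only [one_kronecker_one, krausMap_one, LinearMap.id_apply]

theorem IsLOCC.exists_tensor_right (a b : Type) [Fintype a] [Fintype b] [DecidableEq a]
    [DecidableEq b] {Γ : SuperOp (x × y) (x' × y')} (h : IsLOCC x y Γ) :
    ∃ G : SuperOp ((a × x) × (b × y)) ((a × x') × (b × y')), IsLOCC (a × x) (b × y) G ∧
      ∀ Y Z, G (tensor Y Z) = tensor Y (Γ Z) := by
  obtain ⟨G, hG, hGΓ⟩ := h.exists_tensor_left a b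
  refine ⟨_, (IsLOCC.relabel (.prodComm _ _) (.prodComm _ _)).comp
    (hG.comp (.relabel (.prodComm _ _) (.prodComm _ _))), fun Y Z => ?_⟩
  simp only [LinearMap.comp_apply, krausMap_one_submatrix, tensor_swap, hGΓ]

theorem IsLOCC.exists_tensor {Λ : SuperOp (a × b) (a' × b')} (h : IsLOCC a b Λ)
    {Γ : SuperOp (x × y) (x' × y')} (h' : IsLOCC x y Γ) :
    ∃ G : SuperOp ((a × x) × (b × y)) ((a' × x') × (b' × y')), IsLOCC (a × x) (b × y) G ∧
      ∀ Y Z, G (tensor Y Z) = tensor (Λ Y) (Γ Z) := by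
  obtain ⟨G, hG, hGΛ⟩ := h.exists_tensor_left x y
  obtain ⟨L, hL, hLΓ⟩ := h'.exists_tensor_right a' b'
  exact ⟨_, hL.comp hG, fun Y Z => by rw [LinearMap.comp_apply, hGΛ, hLΓ]⟩

end Tensor

section Implement

variable {a b c x e a' e' : Type} [Fintype x]

theorem withResource_add_left (X Y : Matrix a a ℂ) (ρ : Matrix (b × c) (b × c) ℂ) :
    withResource (X + Y) ρ = withResource X ρ + withResource Y ρ := by
  simp only [withResource, add_kronecker, submatrix_add, Pi.add_apply]

theorem withResource_smul_left (r : ℂ) (X : Matrix a a ℂ) (ρ : Matrix (b × c) (b × c) ℂ) :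
    withResource (r • X) ρ = r • withResource X ρ := by
  simp only [withResource, smul_kronecker, submatrix_smul, Pi.smul_apply]

theorem withResource_add_right (X : Matrix a a ℂ) (ρ σ : Matrix (b × c) (b × c) ℂ) :
    withResource X (ρ + σ) = withResource X ρ + withResource X σ := by
  simp only [withResource, kronecker_add, submatrix_add, Pi.add_apply]

theorem withResource_smul_right (r : ℂ) (X : Matrix a a ℂ) (ρ : Matrix (b × c) (b × c) ℂ) :
    withResource X (r • ρ) = r • withResource X ρ := by
  simp only [withResource, kronecker_smul, submatrix_smul, Pi.smul_apply]

/-- The partial trace over the first tensor factor, as a linear map. -/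
def traceFirstLinearMap (x e : Type) [Fintype x] : SuperOp (x × e) e where
  toFun := traceFirst
  map_add' X Y := by
    ext
    simp [traceFirst, Finset.sum_add_distrib]
  map_smul' r X := by
    ext
    simp [traceFirst, Finset.mul_sum]

/-- The map `X ↦ Tr_X [F (X ⊗ ρ)]` from the operators on `A` to those on `E` that a superoperator
`F` from `(A ⊗ B) ⊗ C` to `X ⊗ E` implements with the resource `ρ`, as a linear function of `ρ`. -/
def implement (F : SuperOp ((a × b) × c) (x × e)) :
    Matrix (b × c) (b × c) ℂ →ₗ[ℂ] SuperOp a e :=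
  LinearMap.mk₂ ℂ (fun ρ X => traceFirstLinearMap x e (F (withResource X ρ)))
    (fun _ _ _ => by simp only [withResource_add_right, map_add])
    (fun _ _ _ => by simp only [withResource_smul_right, map_smul])
    (fun _ _ _ => by simp only [withResource_add_left, map_add])
    (fun _ _ _ => by simp only [withResource_smul_left, map_smul])

theorem implement_apply (F : SuperOp ((a × b) × c) (x × e)) (ρ : Matrix (b × c) (b × c) ℂ)
    (X : Matrix a a ℂ) : implement F ρ X = traceFirst (F (withResource X ρ)) := rfl

theorem implement_sum {ι : Type} [Fintype ι] (F : ι → SuperOp ((a × b) × c) (x × e))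
    (ρ : Matrix (b × c) (b × c) ℂ) : implement (∑ j, F j) ρ = ∑ j, implement (F j) ρ := by
  ext1 X
  change traceFirstLinearMap x e _ = _
  simp only [LinearMap.sum_apply, map_sum]
  rfl

theorem implement_smul (r : ℂ) (F : SuperOp ((a × b) × c) (x × e))
    (ρ : Matrix (b × c) (b × c) ℂ) : implement (r • F) ρ = r • implement F ρ := by
  ext1 X
  exact map_smul (traceFirstLinearMap x e) r _

theorem traceFirst_krausMap_one_kronecker [Fintype e] [DecidableEq x] (V : Matrix e' e ℂ)
    (Y : Matrix (x × e) (x × e) ℂ) :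
    traceFirst (krausMap ((1 : Matrix x x ℂ) ⊗ₖ V) Y) = krausMap V (traceFirst Y) := by
  have hblock (i : x) (k l : e') : krausMap ((1 : Matrix x x ℂ) ⊗ₖ V) Y (i, k) (i, l) =
      krausMap V (Y.submatrix (Prod.mk i) (Prod.mk i)) k l := by
    simp [Matrix.mul_apply, Fintype.sum_prod_type, Matrix.one_apply, Finset.sum_mul, apply_ite]
  have hsum : traceFirst Y = ∑ i, Y.submatrix (Prod.mk i) (Prod.mk i) := by
    ext k l
    simp [traceFirst, Matrix.sum_apply]
  ext k l
  rw [hsum, map_sum, Matrix.sum_apply]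
  exact Finset.sum_congr rfl fun i _ => hblock i k l

theorem implement_krausMap_one_kronecker_comp [Fintype e] [DecidableEq x] (V : Matrix e' e ℂ)
    (F : SuperOp ((a × b) × c) (x × e)) (ρ : Matrix (b × c) (b × c) ℂ) :
    implement (krausMap ((1 : Matrix x x ℂ) ⊗ₖ V) ∘ₗ F) ρ = krausMap V ∘ₗ implement F ρ := by
  ext1 X
  exact traceFirst_krausMap_one_kronecker V _

theorem krausMap_withResource [Fintype a] [Fintype b] [Fintype c] [DecidableEq b] [DecidableEq c]
    (U : Matrix a' a ℂ) (X : Matrix a a ℂ) (ρ : Matrix (b × c) (b × c) ℂ) :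
    krausMap ((U ⊗ₖ (1 : Matrix b b ℂ)) ⊗ₖ (1 : Matrix c c ℂ)) (withResource X ρ) =
      withResource (krausMap U X) ρ := by
  have hU : (U ⊗ₖ (1 : Matrix b b ℂ)) ⊗ₖ (1 : Matrix c c ℂ) =
      (U ⊗ₖ (1 : Matrix (b × c) (b × c) ℂ)).submatrix (Equiv.prodAssoc a' b c)
        (Equiv.prodAssoc a b c) := by
    rw [← one_kronecker_one]
    ext p q
    exact mul_assoc _ _ _
  simp only [withResource, krausMap_apply, hU, conjTranspose_submatrix, submatrix_mul_equiv,
    conjTranspose_kronecker, ← mul_kronecker_mul, conjTranspose_one, Matrix.one_mul,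
    Matrix.mul_one]

theorem implement_comp_krausMap_kronecker_one [Fintype a] [Fintype b] [Fintype c]
    [DecidableEq b] [DecidableEq c] (U : Matrix a' a ℂ)
    (F : SuperOp ((a' × b) × c) (x × e)) (ρ : Matrix (b × c) (b × c) ℂ) :
    implement (F ∘ₗ krausMap ((U ⊗ₖ (1 : Matrix b b ℂ)) ⊗ₖ (1 : Matrix c c ℂ))) ρ =
      implement F ρ ∘ₗ krausMap U := by
  ext1 X
  simp only [LinearMap.comp_apply, implement_apply, krausMap_withResource]

theorem trace_traceFirst [Fintype e] (X : Matrix (x × e) (x × e) ℂ) :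
    (traceFirst X).trace = X.trace := by
  simp only [Matrix.trace, Matrix.diag_apply, traceFirst, of_apply, Fintype.sum_prod_type]
  exact Finset.sum_comm

theorem traceFirst_withResource [Fintype a] [Fintype b] (X : Matrix a a ℂ)
    (ρ : Matrix (b × c) (b × c) ℂ) :
    traceFirst (withResource X ρ) = X.trace • traceFirst ρ := by
  ext k l
  simp [traceFirst, withResource, Matrix.trace, Fintype.sum_prod_type, Finset.sum_mul_sum]

end Implement

section Realizable

variable {d : Type} [Fintype d] [DecidableEq d]

/-- The superoperators that LOCC operations on `(A ⊗ B) ⊗ C` implement with the resource `ρ`. As in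
`IsWireCut`, the basis of each of `A`, `B` and `C` is indexed by `d`, and the outputs on `A` and
`B` are traced out. -/
def Realizable (ρ : Matrix (d × d) (d × d) ℂ) (E : SuperOp d d) : Prop :=
  ∃ F : SuperOp ((d × d) × d) ((d × d) × d), IsLOCC (d × d) d F ∧ implement F ρ = E

variable {ρ : Matrix (d × d) (d × d) ℂ} {E : SuperOp d d}

theorem Realizable.sum_smul {ι : Type} [Fintype ι] {p : ι → ℝ} (hp : ∀ j, 0 ≤ p j)
    (hp' : ∑ j, p j ≤ 1) {E : ι → SuperOp d d} (hE : ∀ j, Realizable ρ (E j)) :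
    Realizable ρ (∑ j, (p j : ℂ) • E j) := by
  choose F hF hE using hE
  exact ⟨_, .sum_smul hp hp' hF, by simp only [implement_sum, implement_smul, hE]⟩

theorem Realizable.add_smul {E' : SuperOp d d} (hE : Realizable ρ E) (hE' : Realizable ρ E')
    {p q : ℝ} (hp : 0 ≤ p) (hq : 0 ≤ q) (hpq : p + q ≤ 1) :
    Realizable ρ ((p : ℂ) • E + (q : ℂ) • E') := by
  have h := Realizable.sum_smul (ρ := ρ) (p := ![p, q]) (E := ![E, E'])
    (Fin.forall_fin_two.2 ⟨hp, hq⟩) (by simpa using hpq) (Fin.forall_fin_two.2 ⟨hE, hE'⟩)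
  simpa using h

theorem realizable_zero : Realizable ρ 0 := by
  simpa using Realizable.sum_smul (ρ := ρ) (ι := Empty) (p := nofun) nofun (by simp)
    (E := nofun) nofun

theorem Realizable.smul (hE : Realizable ρ E) {p : ℝ} (hp : 0 ≤ p) (hp' : p ≤ 1) :
    Realizable ρ ((p : ℂ) • E) := by
  simpa using hE.add_smul hE hp le_rfl (by simpa using hp')

/-- The map `X ↦ U† E(U X U†) U`, which has the same entanglement fidelity as `E` if `U` is
unitary. Twirls are averages of such maps. -/
def conjugate (U : Matrix d d ℂ) (E : SuperOp d d) : SuperOp d d :=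
  krausMap Uᴴ ∘ₗ E ∘ₗ krausMap U

theorem Realizable.conjugate (hE : Realizable ρ E) {U : Matrix d d ℂ} (hU : Uᴴ * U = 1) :
    Realizable ρ (conjugate U E) := by
  obtain ⟨F, hF, rfl⟩ := hE
  have hU' : Uᴴᴴ * Uᴴ = 1 := by rw [conjTranspose_conjTranspose, mul_eq_one_comm, hU]
  have hU₂ : (U ⊗ₖ (1 : Matrix d d ℂ))ᴴ * (U ⊗ₖ (1 : Matrix d d ℂ)) = 1 := by
    simp [conjTranspose_kronecker, ← mul_kronecker_mul, hU]
  have hone {x : Type} [Fintype x] [DecidableEq x] : (1 : Matrix x x ℂ)ᴴ * 1 = 1 := by simp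
  refine ⟨_, (IsLOCC.krausMap_kronecker hone hU').comp
    (hF.comp (.krausMap_kronecker hU₂ hone)), ?_⟩
  rw [implement_krausMap_one_kronecker_comp, implement_comp_krausMap_kronecker_one,
    WireCut.conjugate]

/-- Measure in the computational basis and prepare the basis state `g i` on outcome `i`. -/
def measurePrepare (g : d → d) : SuperOp d d :=
  ∑ i, krausMap (single (g i) i 1)

theorem realizable_measurePrepare (hρ : ρ.trace = 1) (g : d → d) :
    Realizable ρ (measurePrepare g) := by
  have hprep (i : d) : IsKrausFamily fun j : d => single i j (1 : ℂ) :=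
    .of_sum_eq_one (by simp [conjTranspose_single, sum_single_one])
  have hmeas : IsKrausFamily fun i : d => single i i (1 : ℂ) :=
    .of_sum_eq_one (by simp [conjTranspose_single, sum_single_one])
  refine ⟨_, .left_fintype hmeas.kronecker_one
    fun i => .right_fintype (hprep (g i)) fun _ => .done, ?_⟩
  have hdiscard (i : d) (Y : Matrix ((d × d) × d) ((d × d) × d) ℂ) :
      traceFirst (∑ j, krausMap ((1 : Matrix (d × d) (d × d) ℂ) ⊗ₖ single i j (1 : ℂ)) Y) =
        Y.trace • single i i 1 := by
    change traceFirstLinearMap (d × d) d _ = _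
    rw [map_sum, ← trace_traceFirst, Matrix.trace, Finset.sum_smul]
    refine Finset.sum_congr rfl fun j _ => ?_
    change traceFirst _ = _
    simp [traceFirst_krausMap_one_kronecker, conjTranspose_single, single_mul_mul_single,
      smul_single, -krausMap_apply, krausMap_apply (single i j (1 : ℂ))]
  ext1 X
  simp only [implement_sum, LinearMap.sum_apply, measurePrepare]
  refine Finset.sum_congr rfl fun i _ => ?_
  rw [implement_apply, LinearMap.comp_apply, krausMap_withResource, LinearMap.sum_apply]
  simp only [LinearMap.id_comp, hdiscard, ← trace_traceFirst (withResource _ _),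
    traceFirst_withResource, trace_smul, trace_traceFirst ρ, hρ]
  simp [conjTranspose_single, single_mul_mul_single, smul_single]

end Realizable

section Operation

theorem traceFirst_krausMap {a x e : Type} [Fintype a] [Fintype x] (K : Matrix (x × e) a ℂ)
    (X : Matrix a a ℂ) :
    traceFirst (krausMap K X) = ∑ i, krausMap (K.submatrix (Prod.mk i) id) X := by
  ext k l
  rw [Matrix.sum_apply]
  rfl

theorem IsKrausFamily.partialTrace {a x e ι : Type} [DecidableEq a] [Fintype x] [Fintype e]
    [Fintype ι] {K : ι → Matrix (x × e) a ℂ} (hK : IsKrausFamily K) :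
    IsKrausFamily fun q : Σ _ : ι, x => (K q.1).submatrix (Prod.mk q.2) id := by
  have h (j : ι) : (K j)ᴴ * K j =
      ∑ i : x, ((K j).submatrix (Prod.mk i) id)ᴴ * (K j).submatrix (Prod.mk i) id := by
    ext k l
    simp only [Matrix.sum_apply, Matrix.mul_apply, Fintype.sum_prod_type, conjTranspose_apply,
      submatrix_apply, id_eq]
  simpa only [IsKrausFamily, Fintype.sum_sigma, ← h] using hK

variable {a b c x e ι : Type} [Fintype a] [DecidableEq a]

/-- Completely positive trace-nonincreasing superoperators, i.e. those with a Kraus representation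
by a Kraus family. -/
def IsOperation [Fintype e] (E : SuperOp a e) : Prop :=
  ∃ (ι : Type) (_ : Fintype ι) (M : ι → Matrix e a ℂ), E = ∑ j, krausMap (M j) ∧ IsKrausFamily M

/-- Entanglement breaking operations, characterized by a Kraus family of rank-one operators. -/
def IsEntanglementBreaking [Fintype e] (E : SuperOp a e) : Prop :=
  ∃ (ι : Type) (_ : Fintype ι) (w : ι → e → ℂ) (v : ι → a → ℂ),
    E = ∑ j, krausMap (vecMulVec (w j) (v j)) ∧ IsKrausFamily fun j => vecMulVec (w j) (v j)

/-- The Kraus operator of `X ↦ X ⊗ v v†`, from the operators on `A` to those on `(A ⊗ B) ⊗ C`. -/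
def appendKet (a : Type) [DecidableEq a] (v : b × c → ℂ) : Matrix ((a × b) × c) a ℂ :=
  of fun p i => if p.1.1 = i then v (p.1.2, p.2) else 0

theorem krausMap_appendKet (v : b × c → ℂ) (X : Matrix a a ℂ) :
    krausMap (appendKet a v) X = withResource X (vecMulVec v (star v)) := by
  ext p q
  simp [appendKet, withResource, Matrix.mul_apply, vecMulVec_apply, apply_ite]
  ring

variable [Fintype b] [Fintype c]

theorem conjTranspose_appendKet_mul_appendKet (v : b × c → ℂ) :
    (appendKet a v)ᴴ * appendKet a v =
      (vecMulVec v (star v)).trace • (1 : Matrix a a ℂ) := by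
  ext i j
  by_cases h : i = j
  · simp [appendKet, Matrix.mul_apply, Fintype.sum_prod_type, trace_vecMulVec, dotProduct, h,
      mul_comm]
  · simp [appendKet, Matrix.mul_apply, Fintype.sum_prod_type, h, Ne.symm h]

variable [Fintype x] {m : Type} [Fintype m] [Fintype ι]

/-- The Kraus operators `⟨x| L j (1 ⊗ v t)` of the map that an operation with Kraus operators `L j`
implements with the resource `∑ t, v t (v t)†`. -/
def implementKraus (L : ι → Matrix (x × e) ((a × b) × c) ℂ) (v : m → b × c → ℂ) :
    (Σ _ : (Σ _ : m, ι), x) → Matrix e a ℂ :=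
  fun q => (L q.1.2 * appendKet a (v q.1.1)).submatrix (Prod.mk q.2) id

theorem implement_sum_krausMap (L : ι → Matrix (x × e) ((a × b) × c) ℂ) (v : m → b × c → ℂ) :
    implement (∑ j, krausMap (L j)) (∑ t, vecMulVec (v t) (star (v t))) =
      ∑ q, krausMap (implementKraus L v q) := by
  have h (t : m) (j : ι) : implement (krausMap (L j)) (vecMulVec (v t) (star (v t))) =
      ∑ i, krausMap (implementKraus L v ⟨⟨t, j⟩, i⟩) := by
    ext1 X
    rw [implement_apply, ← krausMap_appendKet, ← LinearMap.comp_apply, krausMap_comp,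
      traceFirst_krausMap, LinearMap.sum_apply]
    rfl
  simp only [implement_sum, map_sum, h, Fintype.sum_sigma]

theorem isKrausFamily_implementKraus [Fintype e] [DecidableEq b] [DecidableEq c]
    {L : ι → Matrix (x × e) ((a × b) × c) ℂ} (hL : IsKrausFamily L) {v : m → b × c → ℂ}
    (hv : (∑ t, vecMulVec (v t) (star (v t))).trace = 1) :
    IsKrausFamily (implementKraus L v) := by
  have hket : IsKrausFamily fun t => appendKet a (v t) :=
    .of_sum_eq_one (by
      simp only [conjTranspose_appendKet_mul_appendKet, ← Finset.sum_smul, ← trace_sum, hv,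
        one_smul])
  exact (hket.comp fun _ => hL).partialTrace

theorem IsLOCC.isOperation_implement [Fintype e] [DecidableEq b] [DecidableEq c]
    [DecidableEq x] [DecidableEq e] {F : SuperOp ((a × b) × c) (x × e)} (hF : IsLOCC (a × b) c F)
    {ρ : Matrix (b × c) (b × c) ℂ} (hρ : IsDensity ρ) : IsOperation (implement F ρ) := by
  obtain ⟨ι, _, P, Q, rfl, hPQ⟩ := hF.exists_kraus
  obtain ⟨m, v, rfl⟩ := posSemidef_iff_eq_sum_vecMulVec.1 hρ.1
  exact ⟨_, inferInstance, _, implement_sum_krausMap _ _,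
    isKrausFamily_implementKraus hPQ hρ.2⟩

theorem IsLOCC.isEntanglementBreaking_implement [Fintype e] [DecidableEq b] [DecidableEq c]
    [DecidableEq x] [DecidableEq e] {F : SuperOp ((a × b) × c) (x × e)} (hF : IsLOCC (a × b) c F)
    {σ : Matrix b b ℂ} (hσ : IsDensity σ) {τ : Matrix c c ℂ} (hτ : IsDensity τ) :
    IsEntanglementBreaking (implement F (σ ⊗ₖ τ)) := by
  obtain ⟨ι, _, P, Q, rfl, hPQ⟩ := hF.exists_kraus
  obtain ⟨k, v, hv⟩ := posSemidef_iff_eq_sum_vecMulVec.1 hσ.1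
  obtain ⟨l, w, hw⟩ := posSemidef_iff_eq_sum_vecMulVec.1 hτ.1
  have hvw : σ ⊗ₖ τ = ∑ t : Fin k × Fin l, vecMulVec (fun p => v t.1 p.1 * w t.2 p.2)
      (star fun p => v t.1 p.1 * w t.2 p.2) := by
    ext p q
    simp only [hv, hw, kroneckerMap_apply, Matrix.sum_apply, Finset.sum_mul_sum,
      Fintype.sum_prod_type, vecMulVec_apply, Pi.star_apply, star_mul']
    exact Finset.sum_congr rfl fun _ _ => Finset.sum_congr rfl fun _ _ => mul_mul_mul_comm _ _ _ _
  have hrank (q) : implementKraus (fun j => P j ⊗ₖ Q j)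
      (fun (t : Fin k × Fin l) p => v t.1 p.1 * w t.2 p.2) q =
      vecMulVec (Q q.1.2 *ᵥ w q.1.1.2) (fun i => ∑ s, P q.1.2 q.2 (i, s) * v q.1.1.1 s) := by
    ext k i
    simp only [implementKraus, appendKet, submatrix_apply, Matrix.mul_apply, kroneckerMap_apply,
      Fintype.sum_prod_type, vecMulVec_apply, mulVec, dotProduct, of_apply, mul_ite, mul_zero,
      id_eq, Finset.sum_mul_sum]
    simp only [Finset.sum_ite_irrel, Finset.sum_const_zero, Finset.sum_ite_eq', Finset.mem_univ,
      if_true]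
    rw [Finset.sum_comm]
    exact Finset.sum_congr rfl fun _ _ => Finset.sum_congr rfl fun _ _ => by ring
  have htr := (trace_kronecker σ τ).trans (by rw [hσ.2, hτ.2, one_mul])
  rw [hvw] at htr ⊢
  have hkraus := isKrausFamily_implementKraus hPQ htr
  have himpl := implement_sum_krausMap (fun j => P j ⊗ₖ Q j)
    (fun (t : Fin k × Fin l) p => v t.1 p.1 * w t.2 p.2)
  rw [funext hrank] at hkraus
  simp only [hrank] at himpl
  exact ⟨_, inferInstance, _, _, himpl, hkraus⟩

end Operation

section Fidelity

variable {d : Type} [Fintype d]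

theorem dotProduct_mul_star_dotProduct_le (v w : d → ℂ) :
    (v ⬝ᵥ w) * star (v ⬝ᵥ w) ≤ (v ⬝ᵥ star v) * (w ⬝ᵥ star w) := by
  have hcs : ‖v ⬝ᵥ w‖ ^ 2 ≤ (∑ i, ‖v i‖ ^ 2) * ∑ i, ‖w i‖ ^ 2 :=
    calc ‖v ⬝ᵥ w‖ ^ 2 ≤ (∑ i, ‖v i‖ * ‖w i‖) ^ 2 := by
          gcongr
          exact (norm_sum_le _ _).trans_eq (by simp only [norm_mul])
      _ ≤ _ := Finset.sum_mul_sq_le_sq_mul_sq ..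
  have hnorm (u : d → ℂ) : u ⬝ᵥ star u = ((∑ i, ‖u i‖ ^ 2 : ℝ) : ℂ) := by
    simp [dotProduct, Complex.mul_conj']
  rw [hnorm, hnorm, ← starRingEnd_apply, Complex.mul_conj']
  exact_mod_cast hcs

theorem trace_conjTranspose_mul_self (M : Matrix d d ℂ) :
    (Mᴴ * M).trace = ∑ i, M i ⬝ᵥ star (M i) := by
  simp only [Matrix.trace, Matrix.mul_apply, dotProduct, diag_apply, conjTranspose_apply,
    Pi.star_apply, mul_comm]
  exact Finset.sum_comm

theorem trace_mul_star_trace_le (M : Matrix d d ℂ) :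
    M.trace * star M.trace ≤ Fintype.card d * (Mᴴ * M).trace := by
  have hdiag : diag M ⬝ᵥ star (diag M) ≤ (Mᴴ * M).trace := by
    rw [trace_conjTranspose_mul_self]
    refine Finset.sum_le_sum fun i _ => ?_
    exact Finset.single_le_sum (f := fun j => M i j * star (M i j))
      (fun j _ => mul_star_self_nonneg _) (Finset.mem_univ i)
  calc M.trace * star M.trace
      = ((1 : d → ℂ) ⬝ᵥ diag M) * star ((1 : d → ℂ) ⬝ᵥ diag M) := by
        simp [Matrix.trace, dotProduct]
    _ ≤ ((1 : d → ℂ) ⬝ᵥ star 1) * (diag M ⬝ᵥ star (diag M)) :=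
        dotProduct_mul_star_dotProduct_le _ _
    _ = Fintype.card d * (diag M ⬝ᵥ star (diag M)) := by simp [dotProduct]
    _ ≤ Fintype.card d * (Mᴴ * M).trace := by gcongr

theorem trace_vecMulVec_mul_star_le (w v : d → ℂ) :
    (vecMulVec w v).trace * star (vecMulVec w v).trace ≤
      ((vecMulVec w v)ᴴ * vecMulVec w v).trace := by
  rw [trace_vecMulVec]
  refine (dotProduct_mul_star_dotProduct_le w v).trans_eq ?_
  rw [trace_conjTranspose_mul_self]
  simp only [dotProduct, Finset.sum_mul_sum, vecMulVec_apply, Pi.star_apply, star_mul']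
  exact Finset.sum_congr rfl fun _ _ => Finset.sum_congr rfl fun _ _ => mul_mul_mul_comm ..

theorem trace_superOp [DecidableEq d] (E : SuperOp d d) :
    LinearMap.trace ℂ _ E = ∑ i, ∑ j, E (single i j 1) i j := by
  rw [LinearMap.trace_eq_matrix_trace ℂ (stdBasis ℂ d d), Matrix.trace, Fintype.sum_prod_type]
  simp only [diag_apply, LinearMap.toMatrix_apply, stdBasis_eq_single]
  rfl

theorem trace_krausMap (M : Matrix d d ℂ) :
    LinearMap.trace ℂ _ (krausMap M) = M.trace * star M.trace := by
  classical
  rw [trace_superOp, Matrix.trace, star_sum, Finset.sum_mul_sum]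
  refine Finset.sum_congr rfl fun i _ => Finset.sum_congr rfl fun j _ => ?_
  simp [Matrix.mul_apply, single_apply, ite_and]

/-- The entanglement fidelity of a superoperator, i.e. the fidelity with the maximally entangled
state `Φ` of the result of applying the superoperator to one half of `Φ`. It equals the trace of
the superoperator divided by the square of the dimension. -/
def entanglementFidelity (d : Type) [Fintype d] : SuperOp d d →ₗ[ℂ] ℂ :=
  ((Fintype.card d : ℂ) ^ 2)⁻¹ • LinearMap.trace ℂ _

/-- The probability with which an operation succeeds on the maximally mixed state. -/
def successProb (d : Type) [Fintype d] [DecidableEq d] : SuperOp d d →ₗ[ℂ] ℂ :=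
  (Fintype.card d : ℂ)⁻¹ • traceLinearMap d ℂ ℂ ∘ₗ LinearMap.applyₗ 1

theorem entanglementFidelity_id [Nonempty d] : entanglementFidelity d LinearMap.id = 1 := by
  simp [entanglementFidelity, Module.finrank_matrix, ← sq]

theorem entanglementFidelity_sum_krausMap {ι : Type} [Fintype ι] (M : ι → Matrix d d ℂ) :
    entanglementFidelity d (∑ j, krausMap (M j)) =
      ((Fintype.card d : ℂ) ^ 2)⁻¹ * ∑ j, (M j).trace * star (M j).trace := by
  simp only [entanglementFidelity, LinearMap.smul_apply, map_sum, trace_krausMap, smul_eq_mul,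
    Finset.mul_sum]

variable [DecidableEq d]

theorem successProb_sum_krausMap {ι : Type} [Fintype ι] (M : ι → Matrix d d ℂ) :
    successProb d (∑ j, krausMap (M j)) =
      (Fintype.card d : ℂ)⁻¹ * ∑ j, ((M j)ᴴ * M j).trace := by
  simp [successProb, trace_mul_comm (M _), Finset.mul_sum]

variable {E : SuperOp d d}

theorem IsOperation.entanglementFidelity_nonneg (hE : IsOperation E) :
    0 ≤ entanglementFidelity d E := by
  obtain ⟨ι, _, M, rfl, -⟩ := hE
  rw [entanglementFidelity_sum_krausMap]
  exact mul_nonneg (by positivity) (Finset.sum_nonneg fun j _ => mul_star_self_nonneg _)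

theorem IsOperation.entanglementFidelity_le_successProb (hE : IsOperation E) :
    entanglementFidelity d E ≤ successProb d E := by
  obtain ⟨ι, _, M, rfl, -⟩ := hE
  calc entanglementFidelity d (∑ j, krausMap (M j))
      = ((Fintype.card d : ℂ) ^ 2)⁻¹ * ∑ j, (M j).trace * star (M j).trace :=
        entanglementFidelity_sum_krausMap M
    _ ≤ ((Fintype.card d : ℂ) ^ 2)⁻¹ * ∑ j, Fintype.card d * ((M j)ᴴ * M j).trace :=
        mul_le_mul_of_nonneg_left (Finset.sum_le_sum fun j _ => trace_mul_star_trace_le (M j))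
          (by positivity)
    _ = successProb d (∑ j, krausMap (M j)) := by
        rw [← Finset.mul_sum, ← mul_assoc, successProb_sum_krausMap]
        congr 1
        field_simp

theorem IsOperation.successProb_le_one (hE : IsOperation E) : successProb d E ≤ 1 := by
  obtain ⟨ι, _, M, rfl, hM⟩ := hE
  rw [successProb_sum_krausMap]
  calc (Fintype.card d : ℂ)⁻¹ * ∑ j, ((M j)ᴴ * M j).trace
      ≤ (Fintype.card d : ℂ)⁻¹ * Fintype.card d := by
        gcongr
        exact hM.sum_trace_le
    _ ≤ 1 := inv_mul_le_one

theorem IsEntanglementBreaking.entanglementFidelity_le (hE : IsEntanglementBreaking E) :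
    entanglementFidelity d E ≤ (Fintype.card d : ℂ)⁻¹ := by
  obtain ⟨ι, _, w, v, rfl, hM⟩ := hE
  calc entanglementFidelity d (∑ j, krausMap (vecMulVec (w j) (v j)))
      = ((Fintype.card d : ℂ) ^ 2)⁻¹ * ∑ j, _ := entanglementFidelity_sum_krausMap _
    _ ≤ ((Fintype.card d : ℂ) ^ 2)⁻¹ * Fintype.card d := by
        gcongr
        exact (Finset.sum_le_sum fun j _ => trace_vecMulVec_mul_star_le _ _).trans hM.sum_trace_le
    _ = (Fintype.card d : ℂ)⁻¹ := by
        field_simp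

end Fidelity

section Robustness

variable {d : Type} [Fintype d] [DecidableEq d] {F : SuperOp ((d × d) × d) ((d × d) × d)}
  {ρ ω : Matrix (d × d) (d × d) ℂ}

/-- The real part of the entanglement fidelity as an `ℝ`-linear function of the resource. -/
def resourceFidelity (F : SuperOp ((d × d) × d) ((d × d) × d)) :
    Matrix (d × d) (d × d) ℂ →ₗ[ℝ] ℝ :=
  Complex.reLm ∘ₗ (entanglementFidelity d ∘ₗ implement F).restrictScalars ℝ

theorem IsLOCC.resourceFidelity_le_of_mem_separableStates (hF : IsLOCC (d × d) d F)
    (hρ : ρ ∈ separableStates d d) : resourceFidelity F ρ ≤ (Fintype.card d : ℝ)⁻¹ := by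
  have hsub : separableStates d d ⊆ {σ | resourceFidelity F σ ≤ (Fintype.card d : ℝ)⁻¹} := by
    refine convexHull_min ?_ (convex_halfSpace_le (resourceFidelity F).isLinear _)
    rintro _ ⟨σ, τ, hσ, hτ, rfl⟩
    have h := Complex.re_le_re (hF.isEntanglementBreaking_implement hσ hτ).entanglementFidelity_le
    rwa [← Complex.ofReal_natCast, ← Complex.ofReal_inv, Complex.ofReal_re] at h
  exact hsub hρ

theorem IsLOCC.resourceFidelity_le (hF : IsLOCC (d × d) d F) {l : ℝ} (hl : 0 ≤ l)
    (hω : IsDensity ω) (hsep : (1 + l)⁻¹ • (ρ + l • ω) ∈ separableStates d d) :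
    resourceFidelity F ρ ≤ (1 + l) / Fintype.card d := by
  have hmix := hF.resourceFidelity_le_of_mem_separableStates hsep
  have hω₀ : 0 ≤ resourceFidelity F ω :=
    Complex.re_le_re (hF.isOperation_implement hω).entanglementFidelity_nonneg
  rw [map_smul, map_add, map_smul, smul_eq_mul, smul_eq_mul, inv_mul_le_iff₀ (by positivity),
    ← div_eq_mul_inv] at hmix
  exact (le_add_of_nonneg_right (mul_nonneg hl hω₀)).trans hmix

end Robustness

section Twirl

variable {d : Type} [Fintype d] [DecidableEq d] {ρ : Matrix (d × d) (d × d) ℂ} {E : SuperOp d d}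

/-- The completely dephasing channel, which deletes the off-diagonal entries. -/
def dephase (d : Type) [DecidableEq d] : SuperOp d d :=
  diagonalLinearMap d ℂ ℂ ∘ₗ diagLinearMap d ℂ ℂ

/-- The completely depolarizing channel `X ↦ (Tr X / dim) 1`. -/
def depolarize (d : Type) [Fintype d] [DecidableEq d] : SuperOp d d :=
  (Fintype.card d : ℂ)⁻¹ • (traceLinearMap d ℂ ℂ).smulRight 1

/-- The average probability that an operation leaves the outcome of a measurement in the
computational basis unchanged. Together with `entanglementFidelity` and `successProb` it determines
the superoperators that are covariant under the monomial unitaries. -/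
def classicalFidelity (d : Type) [Fintype d] [DecidableEq d] : SuperOp d d →ₗ[ℂ] ℂ :=
  (Fintype.card d : ℂ)⁻¹ •
    LinearMap.trace ℂ _ ∘ₗ LinearMap.mulLeft ℂ (dephase d : Module.End ℂ (Matrix d d ℂ))

theorem dephase_apply {d : Type} [DecidableEq d] (X : Matrix d d ℂ) :
    dephase d X = diagonal (diag X) := rfl

theorem depolarize_apply (X : Matrix d d ℂ) :
    depolarize d X = ((Fintype.card d : ℂ)⁻¹ * X.trace) • 1 := by
  simp [depolarize, smul_smul]

theorem classicalFidelity_apply (E : SuperOp d d) :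
    classicalFidelity d E = (Fintype.card d : ℂ)⁻¹ * ∑ i, E (single i i 1) i i := by
  have hdiag (i j : d) : dephase d (E (single i j 1)) i j =
      if i = j then E (single i i 1) i i else 0 := by
    rw [dephase_apply, diagonal_apply]
    split_ifs with h
    · rw [h, diag_apply]
    · rfl
  change (Fintype.card d : ℂ)⁻¹ * LinearMap.trace ℂ _ (dephase d ∘ₗ E) = _
  simp only [trace_superOp, LinearMap.comp_apply, hdiag, Finset.sum_ite_eq, Finset.mem_univ,
    if_true]

theorem trace_comp_conjugate {U : Matrix d d ℂ} (hU : Uᴴ * U = 1) {Δ : SuperOp d d}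
    (hΔ : krausMap U ∘ₗ Δ = Δ ∘ₗ krausMap U) (E : SuperOp d d) :
    LinearMap.trace ℂ _ (Δ ∘ₗ conjugate U E) = LinearMap.trace ℂ _ (Δ ∘ₗ E) := by
  calc LinearMap.trace ℂ _ ((Δ ∘ₗ krausMap Uᴴ ∘ₗ E) ∘ₗ krausMap U)
      = LinearMap.trace ℂ _ ((krausMap U ∘ₗ Δ) ∘ₗ krausMap Uᴴ ∘ₗ E) :=
        LinearMap.trace_comp_comm' ..
    _ = LinearMap.trace ℂ _ (Δ ∘ₗ (krausMap U ∘ₗ krausMap Uᴴ) ∘ₗ E) := by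
        rw [hΔ]
        rfl
    _ = LinearMap.trace ℂ _ (Δ ∘ₗ E) := by
        rw [krausMap_comp, mul_eq_one_comm.1 hU, krausMap_one, LinearMap.id_comp]

theorem entanglementFidelity_conjugate {U : Matrix d d ℂ} (hU : Uᴴ * U = 1) (E : SuperOp d d) :
    entanglementFidelity d (conjugate U E) = entanglementFidelity d E :=
  congrArg (((Fintype.card d : ℂ) ^ 2)⁻¹ • ·) (trace_comp_conjugate hU (Δ := LinearMap.id) rfl E)

theorem successProb_conjugate {U : Matrix d d ℂ} (hU : Uᴴ * U = 1) (E : SuperOp d d) :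
    successProb d (conjugate U E) = successProb d E := by
  have hU' : U * Uᴴ = 1 := mul_eq_one_comm.1 hU
  simp [successProb, conjugate, trace_mul_comm _ U, ← Matrix.mul_assoc, hU']

theorem classicalFidelity_conjugate {U : Matrix d d ℂ} (hU : Uᴴ * U = 1)
    (hΔ : krausMap U ∘ₗ dephase d = dephase d ∘ₗ krausMap U) (E : SuperOp d d) :
    classicalFidelity d (conjugate U E) = classicalFidelity d E :=
  congrArg ((Fintype.card d : ℂ)⁻¹ • ·) (trace_comp_conjugate hU hΔ E)

/-- The uniform average of the conjugates of a superoperator by a finite family of matrices. -/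
def twirl {G : Type} [Fintype G] (U : G → Matrix d d ℂ) (E : SuperOp d d) : SuperOp d d :=
  ∑ g, (((Fintype.card G : ℝ)⁻¹ : ℝ) : ℂ) • conjugate (U g) E

theorem Realizable.twirl (hE : Realizable ρ E) {G : Type} [Fintype G] {U : G → Matrix d d ℂ}
    (hU : ∀ g, (U g)ᴴ * U g = 1) : Realizable ρ (twirl U E) := by
  refine .sum_smul (fun _ => by positivity) ?_ fun g => hE.conjugate (hU g)
  simpa using mul_inv_le_one (a := (Fintype.card G : ℝ))

theorem map_twirl {d G : Type} [Fintype d] [Fintype G] [Nonempty G] {E : SuperOp d d}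
    (φ : SuperOp d d →ₗ[ℂ] ℂ) {U : G → Matrix d d ℂ} (h : ∀ g, φ (conjugate (U g) E) = φ E) :
    φ (twirl U E) = φ E := by
  simp [twirl, h]

theorem twirl_apply_single {G : Type} [Fintype G] (U : G → Matrix d d ℂ) (E : SuperOp d d)
    (i j k l : d) : twirl U E (single i j 1) k l =
      (Fintype.card G : ℂ)⁻¹ * ∑ g, conjugate (U g) E (single i j 1) k l := by
  simp [twirl, LinearMap.sum_apply, Matrix.sum_apply, Finset.mul_sum]

section Phases

/-- The diagonal unitary matrix whose `i`-th diagonal entry is the power `s i` of the imaginary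
unit. -/
def phaseMatrix (s : d → ZMod 4) : Matrix d d ℂ :=
  diagonal fun i => ZMod.stdAddChar (s i)

theorem conjTranspose_phaseMatrix {d : Type} [DecidableEq d] (s : d → ZMod 4) :
    (phaseMatrix s)ᴴ = phaseMatrix (-s) := by
  rw [phaseMatrix, diagonal_conjTranspose]
  congr 1
  ext i
  exact (AddChar.map_neg_eq_conj ..).symm

theorem conjTranspose_phaseMatrix_mul (s : d → ZMod 4) :
    (phaseMatrix s)ᴴ * phaseMatrix s = 1 := by
  rw [conjTranspose_phaseMatrix, phaseMatrix, phaseMatrix, diagonal_mul_diagonal]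
  simp [← AddChar.map_add_eq_mul]

theorem krausMap_phaseMatrix_apply (s : d → ZMod 4) (X : Matrix d d ℂ) (i j : d) :
    krausMap (phaseMatrix s) X i j = ZMod.stdAddChar (s i - s j) * X i j := by
  rw [krausMap_apply, conjTranspose_phaseMatrix, phaseMatrix, phaseMatrix, mul_diagonal,
    diagonal_mul, sub_eq_add_neg, AddChar.map_add_eq_mul, Pi.neg_apply]
  ring

theorem krausMap_phaseMatrix_comp_dephase (s : d → ZMod 4) :
    krausMap (phaseMatrix s) ∘ₗ dephase d = dephase d ∘ₗ krausMap (phaseMatrix s) := by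
  ext1 X
  ext i j
  simp only [LinearMap.comp_apply, dephase_apply, krausMap_phaseMatrix_apply, diagonal_apply,
    diag_apply, mul_ite, mul_zero]
  split_ifs with h
  · rw [h]
  · rfl

theorem krausMap_phaseMatrix_single (s : d → ZMod 4) (i j : d) :
    krausMap (phaseMatrix s) (single i j 1) =
      (ZMod.stdAddChar (s i - s j) : ℂ) • single i j 1 := by
  ext p q
  rw [krausMap_phaseMatrix_apply, Matrix.smul_apply, single_apply, smul_eq_mul]
  split_ifs with h
  · rw [h.1, h.2]
  · rw [mul_zero, mul_zero]

theorem conjugate_phaseMatrix_apply_single (s : d → ZMod 4) (E : SuperOp d d) (i j k l : d) :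
    conjugate (phaseMatrix s) E (single i j 1) k l =
      ZMod.stdAddChar (s i - s j - (s k - s l)) * E (single i j 1) k l := by
  rw [conjugate, LinearMap.comp_apply, LinearMap.comp_apply, krausMap_phaseMatrix_single, map_smul,
    map_smul, conjTranspose_phaseMatrix, Matrix.smul_apply, krausMap_phaseMatrix_apply, smul_eq_mul,
    ← mul_assoc, ← AddChar.map_add_eq_mul]
  congr 2
  simp only [Pi.neg_apply]
  ring

theorem sum_stdAddChar_eq_zero {i j k l : d} (hdiag : ¬(i = j ∧ k = l)) (hpair : ¬(i = k ∧ j = l)) :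
    ∑ s : d → ZMod 4, (ZMod.stdAddChar (s i - s j - (s k - s l)) : ℂ) = 0 := by
  let ev (i : d) : (d → ZMod 4) →+ ZMod 4 := Pi.evalAddMonoidHom _ i
  let χ : AddChar (d → ZMod 4) ℂ :=
    ZMod.stdAddChar.compAddMonoidHom (ev i - ev j - (ev k - ev l))
  change ∑ s, χ s = 0
  rw [AddChar.sum_eq_zero_iff_ne_zero]
  intro hχ
  have htriv (s : d → ZMod 4) : s i - s j - (s k - s l) = 0 := by
    apply ZMod.injective_stdAddChar
    rw [AddChar.map_zero_eq_one]
    exact DFunLike.congr_fun hχ s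
  have hi := htriv (Pi.single i 1)
  have hl := htriv (Pi.single l 1)
  simp only [Pi.single_apply] at hi hl
  split_ifs at hi hl <;> grind only

/-- The average of a superoperator over the conjugations by diagonal matrices of fourth roots of
unity. Square roots would not distinguish `E(|i⟩⟨j|)ᵢⱼ` from `E(|i⟩⟨j|)ⱼᵢ`. -/
def phaseTwirl (E : SuperOp d d) : SuperOp d d := twirl phaseMatrix E

theorem phaseTwirl_apply_single_of_ne (E : SuperOp d d) {i j k l : d} (hdiag : ¬(i = j ∧ k = l))
    (hpair : ¬(i = k ∧ j = l)) : phaseTwirl E (single i j 1) k l = 0 := by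
  simp only [phaseTwirl, twirl_apply_single, conjugate_phaseMatrix_apply_single, ← Finset.sum_mul,
    sum_stdAddChar_eq_zero hdiag hpair, zero_mul, mul_zero]

end Phases

end Twirl

section Permutations

variable {d : Type} [Fintype d] [DecidableEq d]

theorem krausMap_permMatrix (σ : Equiv.Perm d) (X : Matrix d d ℂ) :
    krausMap (σ.permMatrix ℂ) X = X.submatrix σ σ := by
  rw [Equiv.Perm.permMatrix, PEquiv.toMatrix_toPEquiv_eq, krausMap_one_submatrix]

theorem conjTranspose_permMatrix_mul (σ : Equiv.Perm d) :
    (σ.permMatrix ℂ)ᴴ * σ.permMatrix ℂ = 1 := by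
  rw [conjTranspose_permMatrix, ← permMatrix_mul, mul_inv_cancel, permMatrix_one]

theorem krausMap_permMatrix_comp_dephase (σ : Equiv.Perm d) :
    krausMap (σ.permMatrix ℂ) ∘ₗ dephase d = dephase d ∘ₗ krausMap (σ.permMatrix ℂ) := by
  ext1 X
  simp only [LinearMap.comp_apply, krausMap_permMatrix, dephase_apply, submatrix_diagonal_equiv]
  rfl

/-- The average of a superoperator over the conjugations by permutation matrices. -/
def permTwirl (E : SuperOp d d) : SuperOp d d :=
  twirl (fun σ : Equiv.Perm d => σ⁻¹.permMatrix ℂ) E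

theorem permTwirl_apply_single (E : SuperOp d d) (i j k l : d) :
    permTwirl E (single i j 1) k l = (Fintype.card (Equiv.Perm d) : ℂ)⁻¹ *
      ∑ σ : Equiv.Perm d, E (single (σ i) (σ j) 1) (σ k) (σ l) := by
  rw [permTwirl, twirl_apply_single]
  congr 1
  refine Finset.sum_congr rfl fun σ _ => ?_
  have hσ : (single i j (1 : ℂ)).submatrix ⇑σ⁻¹ ⇑σ⁻¹ = single (σ i) (σ j) 1 :=
    submatrix_single_equiv σ⁻¹ σ⁻¹ i j 1
  rw [conjugate, LinearMap.comp_apply, LinearMap.comp_apply, conjTranspose_permMatrix, inv_inv,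
    krausMap_permMatrix, krausMap_permMatrix, hσ, submatrix_apply]

theorem permTwirl_apply_single_perm (E : SuperOp d d) (τ : Equiv.Perm d) (i j k l : d) :
    permTwirl E (single (τ i) (τ j) 1) (τ k) (τ l) = permTwirl E (single i j 1) k l := by
  simp only [permTwirl_apply_single]
  congr 1
  exact Equiv.sum_comp (Equiv.mulRight τ)
    fun σ : Equiv.Perm d => E (single (σ i) (σ j) 1) (σ k) (σ l)

/-- The superoperator `X ↦ x X + y diag X + z (Tr X / dim) 1`. -/
def monomialCovariant (d : Type) [Fintype d] [DecidableEq d] (x y z : ℂ) : SuperOp d d :=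
  x • LinearMap.id + y • dephase d + z • depolarize d

theorem monomialCovariant_apply_single (x y z : ℂ) (i j k l : d) :
    monomialCovariant d x y z (single i j 1) k l = (if i = k ∧ j = l then x else 0) +
      (if i = j ∧ k = l then (if i = k then y else 0) + (Fintype.card d : ℂ)⁻¹ * z else 0) := by
  by_cases hij : i = j <;> by_cases hkl : k = l <;>
    simp [monomialCovariant, dephase_apply, depolarize_apply, single_apply,
      trace_single_eq_of_ne, hij, hkl]
  all_goals grind

/-- The average of a superoperator over the conjugations by monomial matrices. -/
def monomialTwirl (E : SuperOp d d) : SuperOp d d := permTwirl (phaseTwirl E)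

theorem monomialTwirl_apply_single_of_ne (E : SuperOp d d) {i j k l : d}
    (hdiag : ¬(i = j ∧ k = l)) (hpair : ¬(i = k ∧ j = l)) :
    monomialTwirl E (single i j 1) k l = 0 := by
  rw [monomialTwirl, permTwirl_apply_single, Finset.sum_eq_zero, mul_zero]
  intro σ _
  apply phaseTwirl_apply_single_of_ne <;> simpa only [σ.apply_eq_iff_eq]

theorem exists_monomialTwirl_eq [Nontrivial d] (E : SuperOp d d) :
    ∃ x y z, monomialTwirl E = monomialCovariant d x y z := by
  obtain ⟨u, v, huv⟩ := exists_pair_ne d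
  let T (i j k l : d) : ℂ := monomialTwirl E (single i j 1) k l
  have hT (τ : Equiv.Perm d) (i j k l : d) : T (τ i) (τ j) (τ k) (τ l) = T i j k l :=
    permTwirl_apply_single_perm ..
  have hpt (i : d) : T i i i i = T u u u u := by
    simpa using hT (Equiv.swap u i) u u u u
  have htransitive {i j : d} (h : i ≠ j) : ∃ τ : Equiv.Perm d, τ u = i ∧ τ v = j :=
    MulAction.is_two_pretransitive_iff.1 (Equiv.Perm.isMultiplyPretransitive d 2) huv h
  have hcoh {i j : d} (h : i ≠ j) : T i j i j = T u v u v := by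
    obtain ⟨τ, rfl, rfl⟩ := htransitive h
    exact hT τ ..
  have hflip {i k : d} (h : i ≠ k) : T i i k k = T u u v v := by
    obtain ⟨τ, rfl, rfl⟩ := htransitive h
    exact hT τ ..
  have hcard : (Fintype.card d : ℂ) ≠ 0 := Nat.cast_ne_zero.2 Fintype.card_ne_zero
  refine ⟨T u v u v, T u u u u - T u v u v - T u u v v, Fintype.card d * T u u v v, ?_⟩
  refine ext_linearMap ℂ fun i j => LinearMap.ext_ring <| Matrix.ext fun k l => ?_
  change T i j k l = _
  rw [LinearMap.comp_apply, singleLinearMap_apply, monomialCovariant_apply_single,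
    inv_mul_cancel_left₀ hcard]
  by_cases hdiag : i = j ∧ k = l
  · obtain ⟨rfl, rfl⟩ := hdiag
    by_cases hik : i = k
    · subst hik
      simp [hpt]
    · simp [hik, hflip]
  · by_cases hpair : i = k ∧ j = l
    · obtain ⟨rfl, rfl⟩ := hpair
      have hij : i ≠ j := fun h => hdiag ⟨h, h⟩
      simp [hij, hcoh]
    · rw [if_neg hdiag, if_neg hpair, add_zero]
      exact monomialTwirl_apply_single_of_ne E hdiag hpair

theorem Realizable.monomialTwirl {ρ : Matrix (d × d) (d × d) ℂ} {E : SuperOp d d}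
    (hE : Realizable ρ E) : Realizable ρ (monomialTwirl E) :=
  (hE.twirl conjTranspose_phaseMatrix_mul).twirl fun σ => conjTranspose_permMatrix_mul σ⁻¹

theorem map_monomialTwirl {φ : SuperOp d d →ₗ[ℂ] ℂ}
    (hφ : ∀ U, Uᴴ * U = 1 → krausMap U ∘ₗ dephase d = dephase d ∘ₗ krausMap U →
      ∀ E, φ (conjugate U E) = φ E) (E : SuperOp d d) : φ (monomialTwirl E) = φ E := by
  refine (map_twirl φ fun σ => ?_).trans (map_twirl φ fun s => ?_)
  · exact hφ _ (conjTranspose_permMatrix_mul _) (krausMap_permMatrix_comp_dephase _) _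
  · exact hφ _ (conjTranspose_phaseMatrix_mul s) (krausMap_phaseMatrix_comp_dephase s) _

end Permutations

section Isotropic

variable {d : Type} [Fintype d] [DecidableEq d]

theorem entanglementFidelity_monomialCovariant [Nonempty d] (x y z : ℂ) :
    entanglementFidelity d (monomialCovariant d x y z) =
      x + y / Fintype.card d + z / Fintype.card d ^ 2 := by
  have hcard : (Fintype.card d : ℂ) ≠ 0 := Nat.cast_ne_zero.2 Fintype.card_ne_zero
  simp only [entanglementFidelity, LinearMap.smul_apply, trace_superOp,
    monomialCovariant_apply_single]
  simp [Finset.sum_add_distrib]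
  field_simp
  ring

theorem successProb_monomialCovariant [Nonempty d] (x y z : ℂ) :
    successProb d (monomialCovariant d x y z) = x + y + z := by
  have hcard : (Fintype.card d : ℂ) ≠ 0 := Nat.cast_ne_zero.2 Fintype.card_ne_zero
  simp [successProb, monomialCovariant, dephase_apply, depolarize_apply]
  field_simp

theorem classicalFidelity_monomialCovariant [Nonempty d] (x y z : ℂ) :
    classicalFidelity d (monomialCovariant d x y z) = x + y + z / Fintype.card d := by
  have hcard : (Fintype.card d : ℂ) ≠ 0 := Nat.cast_ne_zero.2 Fintype.card_ne_zero
  simp only [classicalFidelity_apply, monomialCovariant_apply_single]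
  simp
  field_simp
  ring

end Isotropic

section Fourier

variable (d : Type) [Fintype d] [Nonempty d]

/-- An arbitrary identification of the basis with a cyclic group, needed for `fourierMatrix`. -/
def cyclicIndex : d ≃ ZMod (Fintype.card d) := Fintype.equivOfCardEq (ZMod.card _).symm

/-- The unitary matrix of the discrete Fourier transform. All that matters is that its entries have
the same absolute value, so that it maps the computational basis to an unbiased one. -/
def fourierMatrix : Matrix d d ℂ :=
  of fun i j => ((√(Fintype.card d))⁻¹ : ℝ) * ZMod.stdAddChar (cyclicIndex d i * cyclicIndex d j)

variable {d}

theorem star_fourierMatrix_mul (m i j : d) :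
    star (fourierMatrix d m i) * fourierMatrix d m j = (Fintype.card d : ℂ)⁻¹ *
      ZMod.stdAddChar (cyclicIndex d m * (cyclicIndex d j - cyclicIndex d i)) := by
  have hnorm : (((√(Fintype.card d))⁻¹ : ℝ) : ℂ) * ((√(Fintype.card d))⁻¹ : ℝ) =
      (Fintype.card d : ℂ)⁻¹ := by
    rw [← Complex.ofReal_mul, ← mul_inv, Real.mul_self_sqrt (Nat.cast_nonneg _),
      Complex.ofReal_inv, Complex.ofReal_natCast]
  rw [fourierMatrix, of_apply, of_apply, star_mul', Complex.star_def, Complex.conj_ofReal,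
    mul_mul_mul_comm, hnorm, ← AddChar.map_neg_eq_conj, ← AddChar.map_add_eq_mul, mul_sub,
    neg_add_eq_sub]

theorem conjTranspose_fourierMatrix_mul [DecidableEq d] :
    (fourierMatrix d)ᴴ * fourierMatrix d = 1 := by
  have hcard : (Fintype.card d : ℂ) ≠ 0 := Nat.cast_ne_zero.2 Fintype.card_ne_zero
  ext i j
  simp only [Matrix.mul_apply, conjTranspose_apply, star_fourierMatrix_mul, ← Finset.mul_sum]
  rw [Equiv.sum_comp (cyclicIndex d) fun m =>
      (ZMod.stdAddChar (m * (cyclicIndex d j - cyclicIndex d i)) : ℂ),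
    AddChar.sum_mulShift _ (ZMod.isPrimitive_stdAddChar _), ZMod.card, Matrix.one_apply]
  simp only [sub_eq_zero, (cyclicIndex d).apply_eq_iff_eq, eq_comm (a := j)]
  split_ifs <;> simp [hcard]

theorem diag_krausMap_fourierMatrix_single [DecidableEq d] (i : d) :
    diag (krausMap (fourierMatrix d) (single i i 1)) = fun _ => (Fintype.card d : ℂ)⁻¹ := by
  ext m
  have hflat := star_fourierMatrix_mul m i i
  rw [sub_self, mul_zero, AddChar.map_zero_eq_one, mul_one] at hflat
  simpa [Matrix.mul_apply, single_apply, ite_and, mul_comm] using hflat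

end Fourier

section Isotropic

variable {d : Type} [Fintype d] [DecidableEq d] {ρ : Matrix (d × d) (d × d) ℂ} {E : SuperOp d d}

theorem classicalFidelity_conjugate_fourierMatrix [Nonempty d] (x y z : ℂ) :
    classicalFidelity d (conjugate (fourierMatrix d) (monomialCovariant d x y z)) =
      x + (y + z) / Fintype.card d := by
  have hcard : (Fintype.card d : ℂ) ≠ 0 := Nat.cast_ne_zero.2 Fintype.card_ne_zero
  have hid (i : d) : krausMap (fourierMatrix d)ᴴ (krausMap (fourierMatrix d) (single i i 1)) =
      single i i 1 := by
    rw [← LinearMap.comp_apply, krausMap_comp, conjTranspose_fourierMatrix_mul, krausMap_one,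
      LinearMap.id_apply]
  have hone : krausMap (fourierMatrix d)ᴴ (1 : Matrix d d ℂ) = 1 := by
    simp [conjTranspose_fourierMatrix_mul]
  have hdephase (i : d) : dephase d (krausMap (fourierMatrix d) (single i i 1)) =
      (Fintype.card d : ℂ)⁻¹ • 1 := by
    rw [dephase_apply, diag_krausMap_fourierMatrix_single, smul_one_eq_diagonal]
  have hdepolarize (i : d) : depolarize d (krausMap (fourierMatrix d) (single i i 1)) =
      (Fintype.card d : ℂ)⁻¹ • 1 := by
    rw [depolarize_apply, krausMap_apply, trace_mul_comm, ← Matrix.mul_assoc,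
      conjTranspose_fourierMatrix_mul, Matrix.one_mul, trace_single_eq_same, mul_one]
  have hvalue (i : d) : conjugate (fourierMatrix d) (monomialCovariant d x y z) (single i i 1) =
      x • single i i 1 + ((y + z) / Fintype.card d) • 1 := by
    simp only [conjugate, monomialCovariant, LinearMap.comp_apply, LinearMap.add_apply,
      LinearMap.smul_apply, LinearMap.id_apply, map_add, map_smul, hid, hone, hdephase, hdepolarize]
    module
  rw [classicalFidelity_apply]
  simp [hvalue]
  field_simp

/-- A mixture of a superoperator with its conjugate by the Fourier matrix. The weights are chosen
such that, on superoperators covariant under the monomial unitaries, the mixture satisfies the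
linear relation between the three functionals that holds for `x id + z depolarize`. -/
def fourierTwirl (E : SuperOp d d) [Nonempty d] : SuperOp d d :=
  (((Fintype.card d + 1 : ℝ)⁻¹ : ℝ) : ℂ) • E +
    ((Fintype.card d / (Fintype.card d + 1) : ℝ) : ℂ) • conjugate (fourierMatrix d) E

/-- A twirl with the same effect as the average over all conjugations by unitary matrices, made up
of finitely many conjugations. -/
def isotropicTwirl (E : SuperOp d d) [Nonempty d] : SuperOp d d :=
  monomialTwirl (fourierTwirl (monomialTwirl E))

theorem map_fourierTwirl {d : Type} [Fintype d] [Nonempty d] {E : SuperOp d d}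
    {φ : SuperOp d d →ₗ[ℂ] ℂ}
    (h : φ (conjugate (fourierMatrix d) E) = φ E) : φ (fourierTwirl E) = φ E := by
  have hcard : (Fintype.card d + 1 : ℂ) ≠ 0 := Nat.cast_add_one_ne_zero _
  simp only [fourierTwirl, map_add, map_smul, h, smul_eq_mul]
  push_cast
  field_simp
  ring

theorem entanglementFidelity_isotropicTwirl [Nonempty d] (E : SuperOp d d) :
    entanglementFidelity d (isotropicTwirl E) = entanglementFidelity d E := by
  rw [isotropicTwirl, map_monomialTwirl fun _ hU _ => entanglementFidelity_conjugate hU,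
    map_fourierTwirl (entanglementFidelity_conjugate conjTranspose_fourierMatrix_mul _),
    map_monomialTwirl fun _ hU _ => entanglementFidelity_conjugate hU]

theorem successProb_isotropicTwirl [Nonempty d] (E : SuperOp d d) :
    successProb d (isotropicTwirl E) = successProb d E := by
  rw [isotropicTwirl, map_monomialTwirl fun _ hU _ => successProb_conjugate hU,
    map_fourierTwirl (successProb_conjugate conjTranspose_fourierMatrix_mul _),
    map_monomialTwirl fun _ hU _ => successProb_conjugate hU]

theorem Realizable.isotropicTwirl [Nonempty d] (hE : Realizable ρ E) :
    Realizable ρ (isotropicTwirl E) := by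
  have h := hE.monomialTwirl
  refine (h.add_smul (h.conjugate conjTranspose_fourierMatrix_mul) (by positivity) (by positivity)
    (le_of_eq ?_)).monomialTwirl
  field_simp
  ring

theorem classicalFidelity_fourierTwirl_monomialCovariant [Nonempty d] (x y z : ℂ) :
    (Fintype.card d + 1) * classicalFidelity d (fourierTwirl (monomialCovariant d x y z)) =
      Fintype.card d * entanglementFidelity d (monomialCovariant d x y z) +
        successProb d (monomialCovariant d x y z) := by
  have hcard : (Fintype.card d : ℂ) ≠ 0 := Nat.cast_ne_zero.2 Fintype.card_ne_zero
  have hcard' : (Fintype.card d + 1 : ℂ) ≠ 0 := Nat.cast_add_one_ne_zero _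
  rw [fourierTwirl, map_add, map_smul, map_smul, classicalFidelity_conjugate_fourierMatrix,
    classicalFidelity_monomialCovariant, entanglementFidelity_monomialCovariant,
    successProb_monomialCovariant]
  push_cast
  simp only [smul_eq_mul]
  field_simp
  ring

theorem exists_isotropicTwirl_eq [Nontrivial d] (E : SuperOp d d) :
    ∃ x z, isotropicTwirl E = monomialCovariant d x 0 z := by
  obtain ⟨x, y, z, hxyz⟩ := exists_monomialTwirl_eq E
  obtain ⟨x', y', z', hxyz'⟩ := exists_monomialTwirl_eq (fourierTwirl (monomialCovariant d x y z))
  suffices hy : y' = 0 by exact ⟨x', z', by rw [isotropicTwirl, hxyz, hxyz', hy]⟩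
  have hrel := classicalFidelity_fourierTwirl_monomialCovariant (d := d) x y z
  rw [← map_fourierTwirl (entanglementFidelity_conjugate conjTranspose_fourierMatrix_mul _),
    ← map_fourierTwirl (successProb_conjugate conjTranspose_fourierMatrix_mul _),
    ← map_monomialTwirl fun _ hU hΔ => classicalFidelity_conjugate hU hΔ,
    ← map_monomialTwirl fun _ hU _ => entanglementFidelity_conjugate hU,
    ← map_monomialTwirl fun _ hU _ => successProb_conjugate hU, hxyz',
    classicalFidelity_monomialCovariant, entanglementFidelity_monomialCovariant,
    successProb_monomialCovariant] at hrel
  have hcard : (Fintype.card d : ℂ) ≠ 0 := Nat.cast_ne_zero.2 Fintype.card_ne_zero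
  have hcard' : (Fintype.card d : ℂ) - 1 ≠ 0 :=
    sub_ne_zero.2 (Nat.cast_ne_one.2 Fintype.one_lt_card.ne')
  field_simp at hrel
  refine (mul_eq_zero.1 ?_).resolve_left (mul_ne_zero hcard hcard')
  linear_combination hrel

/-- The channel of the form `x id + z depolarize` that has entanglement fidelity `0`. In dimension
one there is none, and the formula gives the zero map. -/
def errorMap (d : Type) [Fintype d] [DecidableEq d] : SuperOp d d :=
  ((Fintype.card d : ℂ) ^ 2 - 1)⁻¹ •
    ((Fintype.card d : ℂ) ^ 2 • depolarize d - LinearMap.id)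

theorem errorMap_of_unique [Unique d] : errorMap d = 0 := by
  simp [errorMap]

theorem eq_entanglementFidelity_smul_id {d : Type} [Fintype d] [Unique d] (E : SuperOp d d) :
    E = entanglementFidelity d E • LinearMap.id := by
  classical
  refine Matrix.ext_linearMap ℂ fun i j => LinearMap.ext_ring ?_
  ext k l
  simp [entanglementFidelity, trace_superOp, Subsingleton.elim _ (default : d)]

theorem isotropicTwirl_eq [Nonempty d] (E : SuperOp d d) :
    isotropicTwirl E = entanglementFidelity d E • LinearMap.id +
      (successProb d E - entanglementFidelity d E) • errorMap d := by
  rw [← entanglementFidelity_isotropicTwirl]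
  obtain h | h := subsingleton_or_nontrivial d
  · obtain ⟨_⟩ := nonempty_unique d
    rw [errorMap_of_unique, smul_zero, add_zero, ← eq_entanglementFidelity_smul_id]
  obtain ⟨x, z, hxz⟩ := exists_isotropicTwirl_eq E
  have hcard : (Fintype.card d : ℂ) ≠ 0 := Nat.cast_ne_zero.2 Fintype.card_ne_zero
  have hcard' : (Fintype.card d : ℂ) ^ 2 - 1 ≠ 0 :=
    sub_ne_zero.2 (mod_cast (Nat.one_lt_pow two_ne_zero Fintype.one_lt_card).ne')
  rw [← successProb_isotropicTwirl, hxz, entanglementFidelity_monomialCovariant,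
    successProb_monomialCovariant, errorMap, monomialCovariant]
  match_scalars <;> field_simp <;> ring

theorem Realizable.isotropic [Nonempty d] (hE : Realizable ρ E) :
    Realizable ρ (entanglementFidelity d E • LinearMap.id +
      (successProb d E - entanglementFidelity d E) • errorMap d) :=
  isotropicTwirl_eq E ▸ hE.isotropicTwirl

theorem realizable_errorMap [Nonempty d] (hρ : ρ.trace = 1) : Realizable ρ (errorMap d) := by
  obtain h | h := subsingleton_or_nontrivial d
  · obtain ⟨_⟩ := nonempty_unique d
    rw [errorMap_of_unique]
    exact realizable_zero
  choose g hg using fun i : d => exists_ne i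
  have hf : entanglementFidelity d (measurePrepare g) = 0 := by
    rw [measurePrepare, entanglementFidelity_sum_krausMap]
    simp [trace_single_eq_of_ne, hg]
  have hs : successProb d (measurePrepare g) = 1 := by
    rw [measurePrepare, successProb_sum_krausMap]
    simp [conjTranspose_single]
  simpa [hf, hs] using (realizable_measurePrepare hρ g).isotropic

end Isotropic

section MaxFidelity

variable {d : Type} [Fintype d] [DecidableEq d] {ρ : Matrix (d × d) (d × d) ℂ} {E : SuperOp d d}

theorem Realizable.isOperation (hE : Realizable ρ E) (hρ : IsDensity ρ) : IsOperation E := by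
  obtain ⟨F, hF, rfl⟩ := hE
  exact hF.isOperation_implement hρ

/-- The largest entanglement fidelity with which the identity can be simulated by LOCC with the
resource `ρ`, including the probability of success. The optimal overhead is a function of it. -/
def maxFidelity (ρ : Matrix (d × d) (d × d) ℂ) : ℝ :=
  ⨆ E : {E : SuperOp d d // Realizable ρ E}, (entanglementFidelity d E.1).re

theorem Realizable.re_entanglementFidelity_le_one (hE : Realizable ρ E) (hρ : IsDensity ρ) :
    (entanglementFidelity d E).re ≤ 1 :=
  have hE := hE.isOperation hρ
  Complex.re_le_re (hE.entanglementFidelity_le_successProb.trans hE.successProb_le_one)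

theorem Realizable.re_entanglementFidelity_le (hE : Realizable ρ E) (hρ : IsDensity ρ) :
    (entanglementFidelity d E).re ≤ maxFidelity ρ :=
  le_ciSup (f := fun E : {E // Realizable ρ E} => (entanglementFidelity d E.1).re)
    ⟨1, Set.forall_mem_range.2 fun E => E.2.re_entanglementFidelity_le_one hρ⟩ ⟨E, hE⟩

theorem maxFidelity_le {r : ℝ} (h : ∀ E, Realizable ρ E → (entanglementFidelity d E).re ≤ r) :
    maxFidelity ρ ≤ r :=
  have : Nonempty {E : SuperOp d d // Realizable ρ E} := ⟨0, realizable_zero⟩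
  ciSup_le fun E => h E E.2

theorem maxFidelity_le_one (hρ : IsDensity ρ) : maxFidelity ρ ≤ 1 :=
  maxFidelity_le fun _ hE => hE.re_entanglementFidelity_le_one hρ

theorem IsDensity.nonempty {a : Type} [Fintype a] {σ : Matrix a a ℂ} (hσ : IsDensity σ) :
    Nonempty a := by
  by_contra h
  rw [not_nonempty_iff] at h
  simpa [Matrix.trace] using hσ.2

theorem card_inv_le_maxFidelity (hρ : IsDensity ρ) :
    (Fintype.card d : ℝ)⁻¹ ≤ maxFidelity ρ := by
  have : Nonempty d := hρ.nonempty.map Prod.fst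
  have hre : (entanglementFidelity d (measurePrepare id)).re = (Fintype.card d : ℝ)⁻¹ := by
    rw [measurePrepare, entanglementFidelity_sum_krausMap, ← Complex.ofReal_re (_⁻¹)]
    congr 1
    simp [field]
  rw [← hre]
  exact (realizable_measurePrepare hρ.2 id).re_entanglementFidelity_le hρ

theorem maxFidelity_pos (hρ : IsDensity ρ) : 0 < maxFidelity ρ :=
  have : Nonempty d := hρ.nonempty.map Prod.fst
  (by positivity : (0 : ℝ) < (Fintype.card d : ℝ)⁻¹).trans_le (card_inv_le_maxFidelity hρ)

theorem IsDensity.posSemidef_one_sub {a : Type} [Fintype a] [DecidableEq a] {σ : Matrix a a ℂ}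
    (hσ : IsDensity σ) : (1 - σ).PosSemidef := by
  have hσ' := hσ.1.isHermitian
  have hsum : ∑ i, hσ'.eigenvalues i = 1 :=
    Complex.ofReal_injective (by simpa using hσ'.trace_eq_sum_eigenvalues.symm.trans hσ.2)
  have hle (i : a) : hσ'.eigenvalues i ≤ 1 :=
    hsum ▸ Finset.single_le_sum (fun j _ => hσ.1.eigenvalues_nonneg j) (Finset.mem_univ i)
  have hdiag : (1 - diagonal fun i => (hσ'.eigenvalues i : ℂ)).PosSemidef := by
    rw [← diagonal_one, diagonal_sub, posSemidef_diagonal_iff]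
    exact fun i => sub_nonneg.2 (mod_cast hle i)
  rw [hσ'.spectral_theorem, ← map_one (Unitary.conjStarAlgAut ℂ _ hσ'.eigenvectorUnitary),
    ← map_sub, Unitary.conjStarAlgAut_apply]
  exact hdiag.mul_mul_conjTranspose_same _

theorem isDensity_card_inv_smul_one {a : Type} [Fintype a] [DecidableEq a] [Nonempty a] :
    IsDensity ((Fintype.card a : ℂ)⁻¹ • (1 : Matrix a a ℂ)) :=
  ⟨PosSemidef.one.smul (inv_nonneg.2 (Nat.cast_nonneg _)), by simp⟩

theorem robustness_set_nonempty {a b : Type} [Fintype a] [Fintype b]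
    {σ : Matrix (a × b) (a × b) ℂ} (hσ : IsDensity σ) :
    {l : ℝ | 0 ≤ l ∧ ∃ ω : Matrix (a × b) (a × b) ℂ, IsDensity ω ∧
      (1 + l)⁻¹ • (σ + l • ω) ∈ separableStates a b}.Nonempty := by
  classical
  obtain ⟨⟨x, y⟩⟩ := hσ.nonempty
  have : Nonempty a := ⟨x⟩
  have : Nonempty b := ⟨y⟩
  set N : ℝ := (Fintype.card (a × b) : ℝ) with hN
  have hN₀ : 0 < N := Nat.cast_pos.2 Fintype.card_pos
  refine ⟨N, hN₀.le, N⁻¹ • ((1 - σ) + N⁻¹ • 1), ⟨?_, ?_⟩, ?_⟩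
  · exact (hσ.posSemidef_one_sub.add (PosSemidef.one.smul (by positivity))).smul (by positivity)
  · have hN' : (N : ℂ) ≠ 0 := Complex.ofReal_ne_zero.2 hN₀.ne'
    simp only [trace_smul, trace_add, trace_sub, trace_one, hσ.2, Complex.real_smul]
    rw [← Complex.ofReal_natCast, ← hN]
    push_cast
    field_simp
    ring
  have hmix : (1 + N)⁻¹ • (σ + N • N⁻¹ • ((1 - σ) + N⁻¹ • 1)) =
      ((Fintype.card a : ℂ)⁻¹ • (1 : Matrix a a ℂ)) ⊗ₖ
        ((Fintype.card b : ℂ)⁻¹ • (1 : Matrix b b ℂ)) := by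
    have hN' : (1 + N)⁻¹ * (1 + N⁻¹) = (Fintype.card a : ℝ)⁻¹ * (Fintype.card b : ℝ)⁻¹ := by
      rw [← mul_inv, ← Nat.cast_mul, ← Fintype.card_prod, ← hN]
      field_simp
      ring
    have hsum : σ + (1 - σ + N⁻¹ • 1) = (1 + N⁻¹) • 1 := by
      rw [← add_assoc, add_sub_cancel, add_smul, one_smul]
    rw [smul_kronecker, kronecker_smul, one_kronecker_one, smul_inv_smul₀ hN₀.ne', hsum,
      smul_smul, smul_smul, hN', ← Complex.coe_smul]
    push_cast
    rfl
  rw [hmix]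
  exact subset_convexHull ℝ _ ⟨_, _, isDensity_card_inv_smul_one, isDensity_card_inv_smul_one, rfl⟩

theorem maxFidelity_le_one_add_robustness_div (hρ : IsDensity ρ) :
    maxFidelity ρ ≤ (1 + robustness ρ) / Fintype.card d := by
  have : Nonempty d := hρ.nonempty.map Prod.fst
  refine maxFidelity_le ?_
  rintro _ ⟨F, hF, rfl⟩
  rw [le_div_iff₀ (by positivity), ← sub_le_iff_le_add']
  refine le_csInf (robustness_set_nonempty hρ) ?_
  rintro l ⟨hl, ω, hω, hsep⟩
  rw [sub_le_iff_le_add', ← le_div_iff₀ (by positivity)]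
  exact hF.resourceFidelity_le hl hω hsep

end MaxFidelity

section Cut

variable {d : Type} [Fintype d] [DecidableEq d] {ρ : Matrix (d × d) (d × d) ℂ} {E : SuperOp d d}

open scoped MatrixOrder in
theorem eq_id_of_forall_isDensity {d : Type} [Fintype d] {E : SuperOp d d}
    (h : ∀ φ, IsDensity φ → E φ = φ) : E = LinearMap.id := by
  classical
  refine LinearMap.ext_on (s := {X : Matrix d d ℂ | 0 ≤ X}) CStarAlgebra.span_nonneg
    fun X hX => ?_
  have hX : X.PosSemidef := nonneg_iff_posSemidef.1 hX
  by_cases htr : X.trace = 0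
  · simp [hX.trace_eq_zero_iff.1 htr]
  have hφ : IsDensity (X.trace⁻¹ • X) :=
    ⟨hX.smul (inv_nonneg.2 hX.trace_nonneg), by simp [htr]⟩
  simpa [smul_smul, htr] using congrArg (X.trace • ·) (h _ hφ)

theorem isWireCut_iff {N : ℕ} {c : Fin N → ℝ} {F : Fin N → SuperOp ((d × d) × d) ((d × d) × d)} :
    IsWireCut ρ c F ↔ (∀ i, IsLOCC (d × d) d (F i)) ∧ ∑ i, c i = 1 ∧
      ∑ i, (c i : ℂ) • implement (F i) ρ = LinearMap.id := by
  have hsum : implement (∑ i, (c i : ℂ) • F i) ρ = ∑ i, (c i : ℂ) • implement (F i) ρ := by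
    simp only [implement_sum, implement_smul]
  rw [← hsum]
  exact and_congr_right' (and_congr_right'
    ⟨fun h => eq_id_of_forall_isDensity h, fun h φ _ => LinearMap.congr_fun h φ⟩)

theorem IsWireCut.le_sum_abs {N : ℕ} {c : Fin N → ℝ}
    {F : Fin N → SuperOp ((d × d) × d) ((d × d) × d)} (h : IsWireCut ρ c F) (hρ : IsDensity ρ) :
    2 / maxFidelity ρ - 1 ≤ ∑ i, |c i| := by
  obtain ⟨hF, hc, hid⟩ := isWireCut_iff.1 h
  have : Nonempty d := hρ.nonempty.map Prod.fst
  have hfid : ∑ i, c i * (entanglementFidelity d (implement (F i) ρ)).re = 1 := by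
    simpa [entanglementFidelity_id] using congrArg (fun E => (entanglementFidelity d E).re) hid
  have hterm (i : Fin N) : c i * (entanglementFidelity d (implement (F i) ρ)).re ≤
      (|c i| + c i) / 2 * maxFidelity ρ := by
    have hE : Realizable ρ (implement (F i) ρ) := ⟨F i, hF i, rfl⟩
    have hfid₀ : 0 ≤ (entanglementFidelity d (implement (F i) ρ)).re :=
      Complex.re_le_re (hE.isOperation hρ).entanglementFidelity_nonneg
    refine mul_le_mul ?_ (hE.re_entanglementFidelity_le hρ) hfid₀ ?_
    · linarith [le_abs_self (c i)]
    · linarith [neg_abs_le (c i)]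
  have hsum := Finset.sum_le_sum fun i (_ : i ∈ Finset.univ) => hterm i
  rw [hfid, ← Finset.sum_mul, ← Finset.sum_div, Finset.sum_add_distrib, hc] at hsum
  rw [sub_le_iff_le_add, div_le_iff₀ (maxFidelity_pos hρ)]
  linarith

theorem exists_isWireCut_of_smul_sub_smul_eq_id {E₁ E₂ : SuperOp d d} (h₁ : Realizable ρ E₁)
    (h₂ : Realizable ρ E₂) {x : ℝ} (hx : 0 ≤ x)
    (hid : ((x + 1 : ℝ) : ℂ) • E₁ - (x : ℂ) • E₂ = LinearMap.id) :
    ∃ (N : ℕ) (c : Fin N → ℝ) (F : Fin N → SuperOp ((d × d) × d) ((d × d) × d)),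
      IsWireCut ρ c F ∧ 2 * x + 1 = ∑ i, |c i| := by
  obtain ⟨F₁, hF₁, rfl⟩ := h₁
  obtain ⟨F₂, hF₂, rfl⟩ := h₂
  refine ⟨2, ![x + 1, -x], ![F₁, F₂],
    isWireCut_iff.2 ⟨Fin.forall_fin_two.2 ⟨hF₁, hF₂⟩, by simp, ?_⟩, ?_⟩
  · rw [← hid, Fin.sum_univ_two]
    simp only [cons_val_zero, cons_val_one]
    push_cast
    module
  · simp only [Fin.sum_univ_two, cons_val_zero, cons_val_one, abs_neg, abs_of_nonneg hx,
      abs_of_nonneg (add_nonneg hx zero_le_one)]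
    ring

-- An error rate of `p - f` in the twirled operation is cancelled by subtracting a pure error.
theorem exists_isWireCut (hρ : IsDensity ρ) (hE : Realizable ρ E)
    (hf : 0 < (entanglementFidelity d E).re) :
    ∃ (N : ℕ) (c : Fin N → ℝ) (F : Fin N → SuperOp ((d × d) × d) ((d × d) × d)),
      IsWireCut ρ c F ∧ 2 / (entanglementFidelity d E).re - 1 = ∑ i, |c i| := by
  have : Nonempty d := hρ.nonempty.map Prod.fst
  have hop := hE.isOperation hρ
  have hf₀ := hop.entanglementFidelity_nonneg
  have hfp := hop.entanglementFidelity_le_successProb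
  have hp := hop.successProb_le_one
  have hiso := hE.isotropic
  generalize entanglementFidelity d E = f at *
  generalize successProb d E = p at *
  lift p to ℝ using (Complex.nonneg_iff.1 (hf₀.trans hfp)).2.symm
  lift f to ℝ using (Complex.nonneg_iff.1 hf₀).2.symm
  norm_cast at hfp hp
  rw [Complex.ofReal_re] at hf ⊢
  have hr₀ : 0 ≤ (p - f) / (1 - f) := div_nonneg (by linarith) (by linarith)
  have hr₁ : (p - f) / (1 - f) ≤ 1 := div_le_one_of_le₀ (by linarith) (by linarith)
  have hr : (f⁻¹ - 1) * ((p - f) / (1 - f)) = f⁻¹ * (p - f) := by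
    obtain rfl | hf₁ := eq_or_ne f 1
    · simp [hp.antisymm hfp]
    have := sub_ne_zero.2 hf₁.symm
    field_simp
  have hx : 0 ≤ f⁻¹ - 1 := sub_nonneg.2 (one_le_inv₀ hf |>.2 (hfp.trans hp))
  have hcut := exists_isWireCut_of_smul_sub_smul_eq_id hiso
    ((realizable_errorMap hρ.2).smul hr₀ hr₁) hx ?_
  · rwa [show 2 / f - 1 = 2 * (f⁻¹ - 1) + 1 by ring]
  · have hf' : (f : ℂ) ≠ 0 := Complex.ofReal_ne_zero.2 hf.ne'
    rw [smul_smul, ← Complex.ofReal_mul, hr, sub_add_cancel]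
    push_cast
    match_scalars <;> field_simp
    ring

theorem overhead_eq (hρ : IsDensity ρ) : overhead ρ = 2 / maxFidelity ρ - 1 := by
  have hpos := maxFidelity_pos hρ
  have hle {E : SuperOp d d} (hE : Realizable ρ E) (hf : 0 < (entanglementFidelity d E).re) :
      overhead ρ ≤ 2 / (entanglementFidelity d E).re - 1 := by
    refine csInf_le ⟨2 / maxFidelity ρ - 1, ?_⟩ (exists_isWireCut hρ hE hf)
    rintro _ ⟨N, c, F, h, rfl⟩
    exact h.le_sum_abs hρ
  have hne : ∃ E, Realizable ρ E ∧ 0 < (entanglementFidelity d E).re := by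
    by_contra! h
    exact hpos.not_ge (maxFidelity_le h)
  obtain ⟨E₀, hE₀, hf₀⟩ := hne
  refine le_antisymm ?_ (le_csInf ⟨_, exists_isWireCut hρ hE₀ hf₀⟩ ?_)
  · have hnonneg : 0 ≤ overhead ρ := by
      refine Real.sInf_nonneg ?_
      rintro _ ⟨N, c, F, -, rfl⟩
      exact Finset.sum_nonneg fun _ _ => abs_nonneg _
    rw [le_sub_iff_add_le, le_div_comm₀ (by positivity) hpos]
    refine maxFidelity_le fun E hE => ?_
    obtain hf | hf := le_or_gt (entanglementFidelity d E).re 0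
    · exact hf.trans (by positivity)
    · rw [le_div_comm₀ hf (by positivity), ← le_sub_iff_add_le]
      exact hle hE hf
  · rintro _ ⟨N, c, F, h, rfl⟩
    exact h.le_sum_abs hρ

end Cut

section Parallel

theorem traceFirst_submatrix {x x' e e' : Type} [Fintype x] [Fintype x'] (f : x' ≃ x) (g : e' → e)
    (X : Matrix (x × e) (x × e) ℂ) :
    traceFirst (X.submatrix (Prod.map f g) (Prod.map f g)) = (traceFirst X).submatrix g g := by
  ext k l
  exact f.sum_comp fun i => X (i, g k) (i, g l)

theorem traceFirst_tensor {a b x y : Type} [Fintype a] [Fintype x] (Y : Matrix (a × b) (a × b) ℂ)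
    (Z : Matrix (x × y) (x × y) ℂ) :
    traceFirst (tensor Y Z) = traceFirst Y ⊗ₖ traceFirst Z := by
  ext k l
  simp [traceFirst, tensor, Fintype.sum_prod_type, Finset.sum_mul_sum]

theorem withResource_kronecker_tensor {a b c a' b' c' : Type} (X : Matrix a a ℂ)
    (Y : Matrix a' a' ℂ) (ρ : Matrix (b × c) (b × c) ℂ) (ρ' : Matrix (b' × c') (b' × c') ℂ) :
    (withResource (X ⊗ₖ Y) (tensor ρ ρ')).submatrix
      (Prod.map (Equiv.prodProdProdComm a b a' b') (Equiv.refl (c × c')))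
      (Prod.map (Equiv.prodProdProdComm a b a' b') (Equiv.refl (c × c'))) =
      tensor (withResource X ρ) (withResource Y ρ') := by
  ext p q
  exact mul_mul_mul_comm _ _ _ _

variable {d d' : Type} [Fintype d] [Fintype d']

theorem entanglementFidelity_of_kronecker {T : SuperOp (d × d') (d × d')} {E : SuperOp d d}
    {E' : SuperOp d' d'} (hT : ∀ X Y, T (X ⊗ₖ Y) = E X ⊗ₖ E' Y) :
    entanglementFidelity (d × d') T = entanglementFidelity d E * entanglementFidelity d' E' := by
  classical
  have htrace : LinearMap.trace ℂ _ T = LinearMap.trace ℂ _ E * LinearMap.trace ℂ _ E' := by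
    have hsingle (i j : d × d') : single i j (1 : ℂ) =
        single i.1 j.1 (1 : ℂ) ⊗ₖ single i.2 j.2 (1 : ℂ) := by
      rw [single_kronecker_single, mul_one]
    simp only [trace_superOp, hsingle, hT, kroneckerMap_apply, Fintype.sum_prod_type,
      ← Finset.sum_mul_sum]
  simp only [entanglementFidelity, LinearMap.smul_apply, htrace, Fintype.card_prod, smul_eq_mul]
  push_cast
  ring

/-- The superoperator `E` in a basis indexed by `d'` instead of `d`. -/
def reindexSuperOp (e : d' ≃ d) : SuperOp d d ≃ₗ[ℂ] SuperOp d' d' :=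
  (reindexLinearEquiv ℂ ℂ e.symm e.symm).conj

theorem entanglementFidelity_reindexSuperOp (e : d' ≃ d) (E : SuperOp d d) :
    entanglementFidelity d' (reindexSuperOp e E) = entanglementFidelity d E := by
  simp only [entanglementFidelity, reindexSuperOp, LinearMap.smul_apply, LinearMap.trace_conj',
    Fintype.card_congr e]

variable [DecidableEq d] [DecidableEq d'] {ρ : Matrix (d × d) (d × d) ℂ}
  {ρ' : Matrix (d' × d') (d' × d') ℂ}

theorem Realizable.exists_kronecker {E : SuperOp d d} (hE : Realizable ρ E) {E' : SuperOp d' d'}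
    (hE' : Realizable ρ' E') :
    ∃ T, Realizable (tensor ρ ρ') T ∧ ∀ X Y, T (X ⊗ₖ Y) = E X ⊗ₖ E' Y := by
  obtain ⟨F, hF, rfl⟩ := hE
  obtain ⟨F', hF', rfl⟩ := hE'
  obtain ⟨G, hG, hGF⟩ := hF.exists_tensor hF'
  refine ⟨_, ⟨_, (IsLOCC.relabel (.prodProdProdComm d d' d d') (.refl _)).comp
    (hG.comp (.relabel (.prodProdProdComm d d d' d') (.refl _))), rfl⟩, fun X Y => ?_⟩
  simp only [implement_apply, LinearMap.comp_apply, krausMap_one_submatrix,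
    withResource_kronecker_tensor, hGF, traceFirst_submatrix, traceFirst_tensor]
  rfl

theorem IsDensity.submatrix {a b : Type} [Fintype a] [Fintype b] {σ : Matrix a a ℂ}
    (hσ : IsDensity σ) (e : b ≃ a) : IsDensity (σ.submatrix e e) :=
  ⟨hσ.1.submatrix e, by rw [← hσ.2]; exact e.sum_comp fun i => σ i i⟩

theorem IsDensity.submatrix_prodMap {a b : Type} [Fintype a] [Fintype b]
    {σ : Matrix (a × a) (a × a) ℂ} (hσ : IsDensity σ) (e : b ≃ a) :
    IsDensity (σ.submatrix (Prod.map e e) (Prod.map e e)) :=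
  hσ.submatrix (e.prodCongr e)

theorem IsDensity.tensor {a b x y : Type} [Fintype a] [Fintype b] [Fintype x] [Fintype y]
    {σ : Matrix (a × b) (a × b) ℂ} (hσ : IsDensity σ) {τ : Matrix (x × y) (x × y) ℂ}
    (hτ : IsDensity τ) : IsDensity (tensor σ τ) :=
  IsDensity.submatrix ⟨hσ.1.kronecker hτ.1, by rw [trace_kronecker, hσ.2, hτ.2, one_mul]⟩ _

theorem maxFidelity_mul_le (hρ : IsDensity ρ) (hρ' : IsDensity ρ') :
    maxFidelity ρ * maxFidelity ρ' ≤ maxFidelity (tensor ρ ρ') := by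
  have hpos := maxFidelity_pos (hρ.tensor hρ')
  rw [maxFidelity.eq_def ρ, Real.iSup_mul_of_nonneg (maxFidelity_pos hρ').le]
  refine Real.iSup_le (fun ⟨E, hE⟩ => ?_) hpos.le
  obtain ⟨hre, him⟩ := Complex.nonneg_iff.1 (hE.isOperation hρ).entanglementFidelity_nonneg
  rw [maxFidelity.eq_def ρ', Real.mul_iSup_of_nonneg hre]
  refine Real.iSup_le (fun ⟨E', hE'⟩ => ?_) hpos.le
  obtain ⟨T, hT, hTE⟩ := hE.exists_kronecker hE'
  have hle := hT.re_entanglementFidelity_le (hρ.tensor hρ')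
  rwa [entanglementFidelity_of_kronecker hTE, Complex.mul_re, ← him, zero_mul, sub_zero] at hle

theorem Realizable.reindexSuperOp {E : SuperOp d d} (hE : Realizable ρ E) (e : d' ≃ d) :
    Realizable (ρ.submatrix (Prod.map e e) (Prod.map e e)) (reindexSuperOp e E) := by
  obtain ⟨F, hF, rfl⟩ := hE
  refine ⟨_, (IsLOCC.relabel (e.prodCongr e) e).comp
    (hF.comp (.relabel (e.symm.prodCongr e.symm) e.symm)), ?_⟩
  ext1 X
  have hin : (withResource X (ρ.submatrix (Prod.map e e) (Prod.map e e))).submatrix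
      (Prod.map (e.symm.prodCongr e.symm) e.symm) (Prod.map (e.symm.prodCongr e.symm) e.symm) =
      withResource (X.submatrix e.symm e.symm) ρ := by
    ext p q
    simp [withResource]
  simp only [implement_apply, LinearMap.comp_apply, krausMap_one_submatrix, hin,
    traceFirst_submatrix]
  rfl

theorem maxFidelity_le_submatrix (hρ : IsDensity ρ) (e : d' ≃ d) :
    maxFidelity ρ ≤ maxFidelity (ρ.submatrix (Prod.map e e) (Prod.map e e)) :=
  maxFidelity_le fun _ hE => entanglementFidelity_reindexSuperOp e _ ▸
    (hE.reindexSuperOp e).re_entanglementFidelity_le (hρ.submatrix_prodMap e)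

theorem maxFidelity_submatrix (hρ : IsDensity ρ) (e : d' ≃ d) :
    maxFidelity (ρ.submatrix (Prod.map e e) (Prod.map e e)) = maxFidelity ρ := by
  refine le_antisymm ?_ (maxFidelity_le_submatrix hρ e)
  have hle := maxFidelity_le_submatrix (hρ.submatrix_prodMap e) e.symm
  rwa [submatrix_submatrix, Prod.map_comp_map, e.self_comp_symm, Prod.map_id,
    submatrix_id_id] at hle

theorem overhead_submatrix (hρ : IsDensity ρ) (e : d' ≃ d) :
    overhead (ρ.submatrix (Prod.map e e) (Prod.map e e)) = overhead ρ := by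
  rw [overhead_eq (hρ.submatrix_prodMap e), overhead_eq hρ, maxFidelity_submatrix hρ]

end Parallel

section Pi

/-- The state `⨂ i, ρ i`, regarded as a bipartite operator on `A ⊗ B` with `A = ⨂ i, A i` and
`B = ⨂ i, B i`. The product bases are indexed by the dependent functions `∀ i, δ i`. -/
def piState {ι : Type} [Fintype ι] {δ : ι → Type} (ρ : ∀ i, Matrix (δ i × δ i) (δ i × δ i) ℂ) :
    Matrix ((∀ i, δ i) × (∀ i, δ i)) ((∀ i, δ i) × (∀ i, δ i)) ℂ :=
  Matrix.of fun p q => ∏ i, ρ i (p.1 i, p.2 i) (q.1 i, q.2 i)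

theorem piState_succ {m : ℕ} {δ : Fin (m + 1) → Type}
    (ρ : ∀ i, Matrix (δ i × δ i) (δ i × δ i) ℂ) :
    piState ρ = (tensor (ρ 0) (piState fun i => ρ i.succ)).submatrix
      (Prod.map (Fin.consEquiv δ).symm (Fin.consEquiv δ).symm)
      (Prod.map (Fin.consEquiv δ).symm (Fin.consEquiv δ).symm) := by
  ext p q
  exact Fin.prod_univ_succ _

theorem isDensity_piState {m : ℕ} {δ : Fin m → Type} [∀ i, Fintype (δ i)]
    {ρ : ∀ i, Matrix (δ i × δ i) (δ i × δ i) ℂ} (hρ : ∀ i, IsDensity (ρ i)) :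
    IsDensity (piState ρ) := by
  induction m with
  | zero =>
    have hone : piState ρ = 1 := by
      ext p q
      obtain rfl := Subsingleton.elim p q
      simp [piState]
    rw [hone]
    exact ⟨.one, by simp⟩
  | succ m ih =>
    rw [piState_succ]
    exact ((hρ 0).tensor (ih fun i => hρ i.succ)).submatrix_prodMap _

theorem prod_maxFidelity_le {m : ℕ} {δ : Fin m → Type} [∀ i, Fintype (δ i)]
    [∀ i, DecidableEq (δ i)] {ρ : ∀ i, Matrix (δ i × δ i) (δ i × δ i) ℂ}
    (hρ : ∀ i, IsDensity (ρ i)) : ∏ i, maxFidelity (ρ i) ≤ maxFidelity (piState ρ) := by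
  induction m with
  | zero => simpa using card_inv_le_maxFidelity (isDensity_piState hρ)
  | succ m ih =>
    have hρ' := isDensity_piState fun i => hρ i.succ
    rw [piState_succ, maxFidelity_submatrix ((hρ 0).tensor hρ'), Fin.prod_univ_succ]
    exact (mul_le_mul_of_nonneg_left (ih fun i => hρ i.succ) (maxFidelity_pos (hρ 0)).le).trans
      (maxFidelity_mul_le (hρ 0) hρ')

end Pi

section Main

theorem two_mul_prod_sub_one_le_prod {ι : Type} {s : Finset ι} {y : ι → ℝ}
    (hy : ∀ i ∈ s, 1 ≤ y i) : 2 * ∏ i ∈ s, y i - 1 ≤ ∏ i ∈ s, (2 * y i - 1) := by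
  classical
  induction s using Finset.induction_on with
  | empty => norm_num
  | insert i s hi ih =>
    rw [Finset.forall_mem_insert] at hy
    rw [Finset.prod_insert hi, Finset.prod_insert hi]
    have hP : 1 ≤ ∏ j ∈ s, y j := Finset.one_le_prod hy.2
    nlinarith [ih hy.2, mul_nonneg (sub_nonneg.2 hy.1) (sub_nonneg.2 hP)]

theorem two_mul_prod_sub_one_lt_prod {ι : Type} [Fintype ι] {y : ι → ℝ} (hy : ∀ i, 1 ≤ y i)
    {i j : ι} (hij : i ≠ j) (hi : 1 < y i) (hj : 1 < y j) :
    2 * ∏ i, y i - 1 < ∏ i, (2 * y i - 1) := by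
  classical
  have hle := two_mul_prod_sub_one_le_prod fun l (_ : l ∈ Finset.univ.erase i) => hy l
  have hP : 1 < ∏ l ∈ Finset.univ.erase i, y l := by
    simpa using Finset.prod_lt_prod (f := fun _ => 1) (fun _ _ => one_pos) (fun l _ => hy l)
      ⟨j, Finset.mem_erase.2 ⟨hij.symm, Finset.mem_univ j⟩, hj⟩
  rw [← Finset.mul_prod_erase _ _ (Finset.mem_univ i),
    ← Finset.mul_prod_erase _ _ (Finset.mem_univ i)]
  nlinarith [mul_pos (sub_pos.2 hi) (sub_pos.2 hP)]

theorem maxFidelity_lt_one {d : Type} [Fintype d] [DecidableEq d] {ρ : Matrix (d × d) (d × d) ℂ}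
    (hρ : IsDensity ρ) (hNME : robustness ρ < Fintype.card d - 1) : maxFidelity ρ < 1 := by
  have : Nonempty d := hρ.nonempty.map Prod.fst
  refine (maxFidelity_le_one_add_robustness_div hρ).trans_lt ?_
  rw [div_lt_one (by positivity)]
  linarith

theorem theorem2_general {m : ℕ} {δ : Fin m → Type} [∀ i, Fintype (δ i)] [∀ i, DecidableEq (δ i)]
    {ρ : ∀ i, Matrix (δ i × δ i) (δ i × δ i) ℂ} (hρ : ∀ i, IsDensity (ρ i)) {i j : Fin m}
    (hij : i ≠ j) (hi : robustness (ρ i) < Fintype.card (δ i) - 1)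
    (hj : robustness (ρ j) < Fintype.card (δ j) - 1) :
    overhead (piState ρ) < ∏ i, overhead (ρ i) := by
  have hpos l := maxFidelity_pos (hρ l)
  have hlt := two_mul_prod_sub_one_lt_prod (y := fun l => (maxFidelity (ρ l))⁻¹)
    (fun l => (one_le_inv₀ (hpos l)).2 (maxFidelity_le_one (hρ l))) hij
    ((one_lt_inv₀ (hpos i)).2 (maxFidelity_lt_one (hρ i) hi))
    ((one_lt_inv₀ (hpos j)).2 (maxFidelity_lt_one (hρ j) hj))
  have hinv : (maxFidelity (piState ρ))⁻¹ ≤ ∏ l, (maxFidelity (ρ l))⁻¹ := by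
    rw [Finset.prod_inv_distrib]
    exact inv_anti₀ (Finset.prod_pos fun l _ => hpos l) (prod_maxFidelity_le hρ)
  simp only [overhead_eq (hρ _), overhead_eq (isDensity_piState hρ), div_eq_mul_inv]
  linarith

/-- The identification of the joint register with the product of its blocks. -/
def blockEquiv {m : ℕ} (k : Fin m → ℕ) : Qubits (∑ i, k i) ≃ ∀ i, Qubits (k i) :=
  (Equiv.arrowCongr finSigmaFinEquiv.symm (Equiv.refl _)).trans
    (Equiv.piCurry fun i (_ : Fin (k i)) => Fin 2)

theorem compositeState_eq {m : ℕ} {k : Fin m → ℕ}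
    (ρ : ∀ i, Matrix (Qubits (k i) × Qubits (k i)) (Qubits (k i) × Qubits (k i)) ℂ) :
    compositeState ρ = (piState ρ).submatrix (Prod.map (blockEquiv k) (blockEquiv k))
      (Prod.map (blockEquiv k) (blockEquiv k)) := rfl

end Main

end WireCut

end

theorem theorem2 (m : ℕ) (hm : 2 ≤ m) (k : Fin m → ℕ)
    (ρ : ∀ i, Matrix (WireCut.Qubits (k i) × WireCut.Qubits (k i))
      (WireCut.Qubits (k i) × WireCut.Qubits (k i)) ℂ)
    (hρ : ∀ i, WireCut.IsDensity (ρ i))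
    (hNME : ∀ i, WireCut.robustness (ρ i) < 2 ^ k i - 1) :
    WireCut.overhead (WireCut.compositeState ρ) < ∏ i, WireCut.overhead (ρ i) := by
  rw [WireCut.compositeState_eq, WireCut.overhead_submatrix (WireCut.isDensity_piState hρ)]
  exact WireCut.theorem2_general hρ (i := ⟨0, by lia⟩) (j := ⟨1, by lia⟩) (by simp)
    (by simpa using hNME _) (by simpa using hNME _)
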